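/- Let $\Lambda\subset\mathbb C^2$ be a lattice, $\mathbb T^2=\mathbb C^2/\Lambda$ and $\pi:\mathbb C^2\to\mathbb T^2$ the projection. For a subset $X\subset\mathbb T^2$, a horizontal flow box centered at $p=(p_1,p_2)$ consists of an open set $U\subset\mathbb C^2$ on which $\pi$ is injective, a radius $\delta>0$, a set $T\subset\mathbb C$ containing $p_2$, and holomorphic functions $f_w:\Delta_\delta\to\mathbb C$ $(w\in T)$ on $\Delta_\delta=\{|z|<\delta\}$ with $f_w(0)=0$, such that $\psi(z,w)=(p_1+z,\,w+f_w(z))$ is a homeomorphism of $\Delta_\delta\times T$ onto $\pi^{-1}(X)\cap U$. The sets $\Gamma_w=\psi(\Delta_\delta\times\{w\})$ are its plaques. Vertical flow boxes are defined in the same way with the two coordinates of $\mathbb C^2$ exchanged. Two flow boxes are compatible if, for every plaque $\Gamma$ of the one and every plaque $\Gamma'$ of the other, $\pi(\Gamma)\cap\pi(\Gamma')$ is open in both of them for the plaque topologies. A lamination $(X,\mathcal L)$ in $\mathbb T^2$ is a compact set $X\subset\mathbb T^2$ with an atlas of pairwise compatible flow boxes whose images under $\pi$ cover $X$; a flow box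 of $\mathcal L$ is a flow box for $X$ compatible with the atlas. The lamination is Lipschitz if every point of $X$ lies in (the image of) a flow box of $\mathcal L$ for which there is $C>0$ with $$\frac{|\alpha-\beta|}{C}\le |\alpha+f_\alpha(z)-\beta-f_\beta(z)|\le C|\alpha-\beta|\qquad(\alpha,\beta\in T,\ z\in\Delta_\delta).$$ It has invariant complex line segments if there are a complex affine line $Y\subset\mathbb C^2$ and an open set $U\subset\mathbb C^2$ with $\emptyset\ne Y\cap U\subset\pi^{-1}(X)$. Theorem. Let $(X,\mathcal L)$ be a Lipschitz lamination in $\mathbb T^2$ without invariant complex line segments. Then there are a finite covering $\mathcal U$ of $X$ by flow boxes of $\mathcal L$, an integer $N\in\mathbb N$ and $\epsilon_0>0$ such that, for every flow box in $\mathcal U$, all plaques $\Gamma_\alpha,\Gamma_\beta$ of this flow box (possibly equal) and every $\epsilon\in\mathbb C$ with $0<|\epsilon|<\epsilon_0$, $$\mathrm{Card}\big(\pi(\Gamma_\alpha)\cap\pi(\Gamma_\beta^{\epsilon})\big)<N$$ both for the horizontal translate $\Gamma_\beta^\epsilon=\Gamma_\beta+(\epsilon,0)$ and for the vertical translate $\Gamma_\beta^\epsilon=\Gamma_\beta+(0,\epsilon)$.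 In particular $\mathrm{Card}(\Gamma_\alpha\cap\Gamma_\beta^\epsilon)<N$. -/

import Mathlib

/-!
Laminations by Riemann surfaces embedded in a two dimensional complex torus `ℂ² / Λ`.
The torus is the quotient of `ℂ × ℂ` by a lattice `Λ`, and `Λ.mkQ` is the projection `π`.
-/

namespace TorusLamination

/-- The two kinds of graphs: over the first coordinate `z` (horizontal) or over the second
coordinate `w` (vertical). -/
inductive Direction where
  | horizontal
  | vertical

/-- `d.place (a, b)` is the point of `ℂ²` whose coordinate along the direction `d` is `a` and whose
transversal coordinate is `b`. -/
def Direction.place : Direction → ℂ × ℂ → ℂ × ℂ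
  | .horizontal, q => q
  | .vertical, q => q.swap

/-- A (horizontal or vertical) flow box for a subset `X` of the torus. In the horizontal case it is
centered at `p = (base, height)`, and it parametrizes `π⁻¹(X) ∩ U` by
`ψ (z, w) = (base + z, w + f w z)`, with `z` in the disk of radius `δ` around `0` and `w` in the
transversal `T`. In the vertical case the two coordinates of `ℂ²` are exchanged. -/
structure FlowBox (Λ : Submodule ℤ (ℂ × ℂ)) (X : Set ((ℂ × ℂ) ⧸ Λ)) where
  /-- horizontal or vertical -/
  dir : Direction
  /-- the coordinate of the center along the direction of the box -/
  base : ℂ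
  /-- the transversal coordinate of the center -/
  height : ℂ
  /-- the radius of the disk over which the plaques are graphs -/
  δ : ℝ
  /-- the open set of `ℂ²` -/
  U : Set (ℂ × ℂ)
  /-- the transversal -/
  T : Set ℂ
  /-- the functions whose graphs are the plaques -/
  f : ℂ → ℂ → ℂ
  δ_pos : 0 < δ
  height_mem : height ∈ T
  isOpen_U : IsOpen U
  injOn_U : Set.InjOn Λ.mkQ U
  holo : ∀ w ∈ T, DifferentiableOn ℂ (f w) (Metric.ball 0 δ)
  f_zero : ∀ w ∈ T, f w 0 = 0
  /-- `ψ` maps onto the part of `π⁻¹(X)` in `U` -/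
  image_eq : (fun q : ℂ × ℂ => dir.place (base + q.1, q.2 + f q.2 q.1)) ''
    (Metric.ball 0 δ ×ˢ T) = Λ.mkQ ⁻¹' X ∩ U
  /-- `ψ` is a homeomorphism onto its image -/
  isEmbedding : Topology.IsEmbedding
    (fun q : (Metric.ball (0 : ℂ) δ ×ˢ T : Set (ℂ × ℂ)) =>
      dir.place (base + q.1.1, q.1.2 + f q.1.2 q.1.1))

namespace FlowBox

variable {Λ : Submodule ℤ (ℂ × ℂ)} {X : Set ((ℂ × ℂ) ⧸ Λ)}

/-- The parametrization `ψ` of the flow box. -/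
def chart (B : FlowBox Λ X) (z w : ℂ) : ℂ × ℂ :=
  B.dir.place (B.base + z, w + B.f w z)

/-- The plaque `Γ_w` of the flow box, as a subset of `U ⊆ ℂ²`. -/
def plaque (B : FlowBox Λ X) (w : ℂ) : Set (ℂ × ℂ) :=
  (fun z => B.chart z w) '' Metric.ball 0 B.δ

/-- The transversal distance `d_z(Γ_α, Γ_β)`. -/
noncomputable def transDist (B : FlowBox Λ X) (z α β : ℂ) : ℝ :=
  ‖(α + B.f α z) - (β + B.f β z)‖

/-- Each plaque of `B` meets each plaque of `B'`, in the torus, in a set which is open in the plaque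
of `B` (for the topology of the disk that parametrizes it). -/
def MeetsOpenly (B B' : FlowBox Λ X) : Prop :=
  ∀ w ∈ B.T, ∀ w' ∈ B'.T,
    IsOpen {z ∈ Metric.ball (0 : ℂ) B.δ | Λ.mkQ (B.chart z w) ∈ Λ.mkQ '' B'.plaque w'}

/-- Two flow boxes are compatible if their plaques glue to leaves: plaques which meet coincide near
each common point. As charts are homeomorphisms, this says that the change of charts maps
plaques to plaques locally. -/
def Compatible (B B' : FlowBox Λ X) : Prop :=
  B.MeetsOpenly B' ∧ B'.MeetsOpenly B

/-- The transversal distance between two plaques is comparable to the distance of their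
parameters. -/
def IsLipschitz (B : FlowBox Λ X) : Prop :=
  ∃ C : ℝ, 0 < C ∧ ∀ α ∈ B.T, ∀ β ∈ B.T, ∀ z ∈ Metric.ball (0 : ℂ) B.δ,
    ‖α - β‖ / C ≤ B.transDist z α β ∧ B.transDist z α β ≤ C * ‖α - β‖

end FlowBox

end TorusLamination

/-- A lamination by Riemann surfaces, holomorphically embedded in the torus `ℂ² / Λ`: a compact set
with an atlas of compatible flow boxes. -/
structure TorusLamination (Λ : Submodule ℤ (ℂ × ℂ)) where
  /-- the laminated compact set `X` -/
  carrier : Set ((ℂ × ℂ) ⧸ Λ)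
  isCompact_carrier : IsCompact carrier
  /-- an atlas of flow boxes -/
  atlas : Set (TorusLamination.FlowBox Λ carrier)
  covers : carrier ⊆ ⋃ B ∈ atlas, Λ.mkQ '' B.U
  compatible : ∀ B ∈ atlas, ∀ B' ∈ atlas, B.Compatible B'

namespace TorusLamination

variable {Λ : Submodule ℤ (ℂ × ℂ)}

/-- `B` is a flow box of the lamination `L`: it belongs to the maximal atlas. -/
def IsFlowBox (L : TorusLamination Λ) (B : FlowBox Λ L.carrier) : Prop :=
  ∀ B' ∈ L.atlas, B.Compatible B'

/-- The lamination is (transversally) Lipschitz: it is covered by Lipschitz flow boxes. -/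
def IsLipschitz (L : TorusLamination Λ) : Prop :=
  ∀ x ∈ L.carrier, ∃ B : FlowBox Λ L.carrier,
    L.IsFlowBox B ∧ x ∈ Λ.mkQ '' B.U ∧ B.IsLipschitz

/-- The lamination has invariant complex line segments: a nonempty open piece `Y ∩ U` of a complex
affine line `Y` of `ℂ²` is contained in `π⁻¹(X)`. -/
def HasInvariantLineSegment (L : TorusLamination Λ) : Prop :=
  ∃ (Y : AffineSubspace ℂ (ℂ × ℂ)) (U : Set (ℂ × ℂ)),
    Module.finrank ℂ Y.direction = 1 ∧ IsOpen U ∧ ((Y : Set (ℂ × ℂ)) ∩ U).Nonempty ∧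
      (Y : Set (ℂ × ℂ)) ∩ U ⊆ Λ.mkQ ⁻¹' L.carrier

/-- The number of points, in the torus, in which the set `Γ` meets the set `Γ'` translated
by `v`, for `Γ` and `Γ'` in `ℂ²`. -/
noncomputable def crossings (Λ : Submodule ℤ (ℂ × ℂ)) (Γ Γ' : Set (ℂ × ℂ)) (v : ℂ × ℂ) : ℕ∞ :=
  (Λ.mkQ '' Γ ∩ Λ.mkQ '' ((fun x => x + v) '' Γ')).encard

end TorusLamination

/-! Fix a basis vector `v`, with coordinates `(a, b)` in a box, and write `G α` for the function
whose graph is the plaque with parameter `α`. When a plaque meets the translate by `ε v` of another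
one, both near that of `α₀`, the Lipschitz condition forces the two parameters to be `O(ε)`-close,
so the gap between them is `O(ε)`. If the number of crossings were unbounded, compactness would
produce sequences with `n` zeros of the gap in discs shrinking to a point; dividing out the zeros
(`norm_le_of_zeros`) improves the bound to `O((2/3)^n ε) = o(ε)` near that point, and
`isLittleO_defect_of_ball` spreads this over the whole disc. Hence `G β - G α + ε (b - (G α₀)' a) =
o(ε)`: the plaque of `α₀` is `InfinitesimallyInvariant`.

Such plaques do not exist (`not_isInvariant`). Invariance does not depend on the box
(`IsInvariant.transfer`), and it makes `|b - (G α₀)' a|` a limit of differences of plaques, which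
the Lipschitz condition keeps within a factor `C²` of itself along the plaque (`harnack`). Take the
supremum, over all invariant plaques, of `obliquity`, which measures how close the tangent line is
to `v`. By compactness of `X` it is approached near some point of `X`, and the plaque through that
point has maximal obliquity at an interior point. According to the position of `v` in the box, the
maximum principle for `G'` or for `1/G'` shows that `G'` is constant, with `harnack` covering the
case where `G'` vanishes. The plaque is then a piece of a complex line, which is excluded.

Crossings in the torus reduce to zeros of the gap in `ℂ²` because `π` is injective on a box: after
shrinking the box, nonzero lattice vectors play no role. Compactness of `X` gives the finite
covering. -/

namespace TorusLamination

open Filter Topology Metric Set Asymptotics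

/-! ### Estimates for holomorphic functions on discs -/

/-- A holomorphic function with many zeros near the centre of a disc is small there. -/
theorem norm_le_of_zeros {c : ℂ} {R ρ : ℝ} (hρR : ρ < R) (s : Finset ℂ) :
    ∀ (f : ℂ → ℂ) (M : ℝ), DifferentiableOn ℂ f (ball c R) → (∀ z ∈ ball c R, ‖f z‖ ≤ M) →
      (∀ a ∈ s, a ∈ ball c ρ ∧ f a = 0) →
      ∀ z ∈ ball c ρ, ‖f z‖ ≤ M * (2 * ρ / (R - ρ)) ^ s.card := by
  induction s using Finset.induction_on with
  | empty =>
    intro f M _ hM _ z hz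
    simpa using hM z (ball_subset_ball hρR.le hz)
  | insert a s has ih =>
    intro f M hf hM hs z hz
    have ha := hs a (Finset.mem_insert_self _ _)
    have hRρ : 0 < R - ρ := sub_pos.2 hρR
    have haR : a ∈ ball c R := ball_subset_ball hρR.le ha.1
    have hfac : ∀ z, f z = (z - a) * dslope f a z := by
      intro z
      have := sub_smul_dslope f a z
      rw [ha.2, sub_zero, smul_eq_mul] at this
      exact this.symm
    have hsub : ball a (R - ρ) ⊆ ball c R := by
      intro x hx
      have := dist_triangle x a c
      have h1 := ha.1
      rw [mem_ball] at *
      linarith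
    have hg : DifferentiableOn ℂ (dslope f a) (ball c R) :=
      (Complex.differentiableOn_dslope (isOpen_ball.mem_nhds haR)).2 hf
    have hgM : ∀ z ∈ ball c R, ‖dslope f a z‖ ≤ M / (R - ρ) := by
      intro z hz
      -- Near `a` the quotient is bounded by the Schwarz lemma; at distance at least `R - ρ` from
      -- `a` one simply divides by `z - a`.
      by_cases hza : z ∈ ball a (R - ρ)
      · refine Complex.norm_dslope_le_div_of_mapsTo_ball (hf.mono hsub) ?_ hza
        intro x hx
        rw [ha.2, mem_closedBall_zero_iff]
        exact hM x (hsub hx)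
      · have hdz : R - ρ ≤ ‖z - a‖ := by
          rw [mem_ball, not_lt, dist_eq_norm] at hza
          exact hza
        rw [le_div_iff₀ hRρ]
        calc ‖dslope f a z‖ * (R - ρ) ≤ ‖dslope f a z‖ * ‖z - a‖ := by gcongr
          _ = ‖f z‖ := by rw [hfac z, norm_mul, mul_comm]
          _ ≤ M := hM z hz
    have hgs : ∀ b ∈ s, b ∈ ball c ρ ∧ dslope f a b = 0 := by
      intro b hb
      have h := hs b (Finset.mem_insert_of_mem hb)
      refine ⟨h.1, ?_⟩
      have h2 := hfac b
      rw [h.2] at h2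
      rcases mul_eq_zero.1 h2.symm with h3 | h3
      · exact absurd (sub_eq_zero.1 h3 ▸ hb) has
      · exact h3
    have key := ih (dslope f a) (M / (R - ρ)) hg hgM hgs z hz
    have hza : ‖z - a‖ ≤ 2 * ρ := by
      have := dist_triangle_right z a c
      have h1 := ha.1
      rw [mem_ball] at *
      rw [← dist_eq_norm]
      linarith
    rw [hfac z, norm_mul, Finset.card_insert_of_notMem has]
    calc ‖z - a‖ * ‖dslope f a z‖ ≤ (2 * ρ) * (M / (R - ρ) * (2 * ρ / (R - ρ)) ^ s.card) := by
          gcongr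
          exact (norm_nonneg _).trans hza
      _ = M * (2 * ρ / (R - ρ)) ^ (s.card + 1) := by
          rw [pow_succ]
          ring

/-- A bounded sequence of holomorphic functions on a disc which tends to zero on a concentric
disc tends to zero everywhere. -/
theorem tendsto_zero_of_bounded {c : ℂ} {R r M : ℝ} (hr : 0 < r) (h : ℕ → ℂ → ℂ)
    (hd : ∀ᶠ n in atTop, DifferentiableOn ℂ (h n) (ball c R))
    (hM : ∀ᶠ n in atTop, ∀ z ∈ ball c R, ‖h n z‖ ≤ M)
    (h0 : ∀ z ∈ ball c r, Tendsto (fun n => h n z) atTop (𝓝 0)) :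
    ∀ z ∈ ball c R, Tendsto (fun n => h n z) atTop (𝓝 0) := by
  intro z hz
  have hR : 0 < R := pos_of_mem_ball hz
  have hdiff : ∀ᶠ n in atTop, ∀ ρ, ρ < R → DiffContOnCl ℂ (h n) (ball c ρ) := by
    filter_upwards [hd] with n hn ρ hρ
    exact (hn.mono (closedBall_subset_ball hρ)).diffContOnCl_ball subset_rfl
  -- the Taylor coefficients tend to zero
  have hcoef : ∀ k : ℕ, Tendsto (fun n => iteratedDeriv k (h n) c) atTop (𝓝 0) := by
    intro k
    -- The circle must lie in the small disc, where convergence is known, and in the large one,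
    -- where the bounds hold; Cauchy's formula and dominated convergence then apply.
    set ρ := min r R / 2 with hρ
    have hm : 0 < min r R := lt_min hr hR
    have hρ0 : 0 < ρ := by positivity
    have hρr : ρ < r := by linarith [min_le_left r R]
    have hρR : ρ < R := by linarith [min_le_right r R]
    have hint : Tendsto (fun n => ∮ z in C(c, ρ), (1 / (z - c) ^ (k + 1)) • h n z) atTop
        (𝓝 (∫ _ in (0 : ℝ)..2 * Real.pi, (0 : ℂ))) := by
      unfold circleIntegral
      refine intervalIntegral.tendsto_integral_filter_of_dominated_convergence
        (fun _ => ρ * (1 / ρ ^ (k + 1) * M)) ?_ ?_ (by simp) ?_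
      · filter_upwards [hd] with n hn
        refine Continuous.aestronglyMeasurable ?_
        have hc : Continuous fun θ => h n (circleMap c ρ θ) := by
          refine hn.continuousOn.comp_continuous (continuous_circleMap c ρ) fun θ => ?_
          exact closedBall_subset_ball hρR (circleMap_mem_closedBall c hρ0.le θ)
        have hne : ∀ θ, (circleMap c ρ θ - c) ^ (k + 1) ≠ 0 := fun θ =>
          pow_ne_zero _ (sub_ne_zero.2 (circleMap_ne_center hρ0.ne'))
        have h1 : Continuous fun θ => 1 / (circleMap c ρ θ - c) ^ (k + 1) :=
          continuous_const.div (((continuous_circleMap c ρ).sub continuous_const).pow _) hne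
        simp only [deriv_circleMap]
        exact ((continuous_circleMap 0 ρ).mul continuous_const).smul (h1.smul hc)
      · filter_upwards [hM] with n hn
        refine Eventually.of_forall fun θ _ => ?_
        have := hn (circleMap c ρ θ)
          (closedBall_subset_ball hρR (circleMap_mem_closedBall c hρ0.le θ))
        have h2 : ‖circleMap c ρ θ - c‖ = ρ := by
          simp [circleMap, abs_of_pos hρ0]
        have h3 : ‖deriv (circleMap c ρ) θ‖ = ρ := by
          simp [deriv_circleMap, abs_of_pos hρ0]
        rw [norm_smul, norm_smul, h3, norm_div, norm_one, norm_pow, h2]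
        gcongr
      · refine Eventually.of_forall fun θ _ => ?_
        have := h0 (circleMap c ρ θ)
          (closedBall_subset_ball hρr (circleMap_mem_closedBall c hρ0.le θ))
        simpa using (this.const_smul (1 / (circleMap c ρ θ - c) ^ (k + 1))).const_smul
          (deriv (circleMap c ρ) θ)
    rw [intervalIntegral.integral_zero] at hint
    have h4 : ∀ᶠ n in atTop, (2 * Real.pi * Complex.I / k.factorial)⁻¹ •
        (∮ z in C(c, ρ), (1 / (z - c) ^ (k + 1)) • h n z) = iteratedDeriv k (h n) c := by
      filter_upwards [hdiff] with n hn
      rw [DiffContOnCl.circleIntegral_one_div_sub_center_pow_smul hρ0 k (hn ρ hρR), inv_smul_smul₀]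
      simp [Nat.factorial_ne_zero]
    refine Tendsto.congr' h4 ?_
    simpa using hint.const_smul (2 * Real.pi * Complex.I / k.factorial : ℂ)⁻¹
  -- The Cauchy estimates on the circle of radius `R'` dominate the Taylor series at `z` by a
  -- geometric series, uniformly in `n`.
  obtain ⟨R', hzR', hR'⟩ := exists_between (mem_ball.1 hz)
  have hR'0 : 0 < R' := dist_nonneg.trans_lt hzR'
  have hq : dist z c / R' < 1 := (div_lt_one hR'0).2 hzR'
  have hlim : Tendsto (fun n => ∑' k : ℕ, (k.factorial : ℂ)⁻¹ * iteratedDeriv k (h n) c *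
      (z - c) ^ k) atTop (𝓝 (∑' _ : ℕ, 0)) := by
    refine tendsto_tsum_of_dominated_convergence (bound := fun k => M * (dist z c / R') ^ k)
      ((summable_geometric_of_lt_one (by positivity) hq).mul_left M) ?_ ?_
    · intro k
      simpa using ((hcoef k).const_mul (k.factorial : ℂ)⁻¹).mul_const ((z - c) ^ k)
    · filter_upwards [hM, hdiff] with n hn hdn k
      have := Complex.norm_iteratedDeriv_le_of_forall_mem_sphere_norm_le k hR'0 (hdn R' hR')
        (fun x hx => hn x (closedBall_subset_ball hR' (sphere_subset_closedBall hx)))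
      have hk : (0 : ℝ) < k.factorial := by exact_mod_cast k.factorial_pos
      rw [norm_mul, norm_mul, norm_pow, norm_inv, ← dist_eq_norm, RCLike.norm_natCast]
      calc (k.factorial : ℝ)⁻¹ * ‖iteratedDeriv k (h n) c‖ * dist z c ^ k
          ≤ (k.factorial : ℝ)⁻¹ * (k.factorial * M / R' ^ k) * dist z c ^ k := by gcongr
        _ = M * (dist z c / R') ^ k := by
          rw [div_pow]
          field_simp
  rw [tsum_zero] at hlim
  refine Tendsto.congr' ?_ hlim
  filter_upwards [hd] with n hn
  exact Complex.taylorSeries_eq_on_ball' hz hn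

theorem norm_deriv_le_of_bounded {f : ℂ → ℂ} {δ A R : ℝ} (hf : DifferentiableOn ℂ f (ball 0 δ))
    (hA : ∀ z ∈ ball 0 δ, ‖f z‖ ≤ A) (hR : R < δ) {x : ℂ} (hx : x ∈ closedBall 0 R) :
    ‖deriv f x‖ ≤ 2 * A / (δ - R) := by
  have hsub : ball x (δ - R) ⊆ ball 0 δ := by
    intro y hy
    have := dist_triangle y x 0
    rw [mem_ball, mem_closedBall] at *
    linarith
  refine Complex.norm_deriv_le_div_of_mapsTo_ball (hf.mono hsub) ?_ (sub_pos.2 hR)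
  intro y hy
  rw [mem_closedBall, dist_eq_norm]
  calc ‖f y - f x‖ ≤ ‖f y‖ + ‖f x‖ := norm_sub_le _ _
    _ ≤ A + A := add_le_add (hA y (hsub hy)) (hA x (closedBall_subset_ball hR hx))
    _ = 2 * A := by ring

theorem norm_sub_le_of_bounded {f : ℂ → ℂ} {δ A R : ℝ} (hf : DifferentiableOn ℂ f (ball 0 δ))
    (hA : ∀ z ∈ ball 0 δ, ‖f z‖ ≤ A) (hR : R < δ) {x y : ℂ} (hx : x ∈ closedBall 0 R)
    (hy : y ∈ closedBall 0 R) : ‖f x - f y‖ ≤ 2 * A / (δ - R) * ‖x - y‖ :=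
  (convex_closedBall (0 : ℂ) R).norm_image_sub_le_of_norm_deriv_le
    (fun _ hz => hf.differentiableAt (isOpen_ball.mem_nhds (closedBall_subset_ball hR hz)))
    (fun _ hz => norm_deriv_le_of_bounded hf hA hR hz) hy hx

/-! ### Lipschitz families of graphs and infinitesimal invariance -/

/-- A family of holomorphic functions on a disc whose mutual distances are comparable to those of
their parameters. -/
structure LipFamily (T : Set ℂ) (δ C : ℝ) (G : ℂ → ℂ → ℂ) : Prop where
  pos : 0 < C
  diff : ∀ w ∈ T, DifferentiableOn ℂ (G w) (ball 0 δ)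
  lower : ∀ α ∈ T, ∀ β ∈ T, ∀ z ∈ ball (0 : ℂ) δ, ‖α - β‖ ≤ C * ‖G α z - G β z‖
  upper : ∀ α ∈ T, ∀ β ∈ T, ∀ z ∈ ball (0 : ℂ) δ, ‖G α z - G β z‖ ≤ C * ‖α - β‖

/-- Two sequences of parameters converging to `α₀`, and a sequence of nonzero numbers converging
to `0`. -/
structure ConvergentPairs (T : Set ℂ) (α₀ : ℂ) (α β ε : ℕ → ℂ) : Prop where
  mem_left : ∀ᶠ n in atTop, α n ∈ T
  mem_right : ∀ᶠ n in atTop, β n ∈ T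
  ne_zero : ∀ᶠ n in atTop, ε n ≠ 0
  left : Tendsto α atTop (𝓝 α₀)
  right : Tendsto β atTop (𝓝 α₀)
  zero : Tendsto ε atTop (𝓝 0)

/-- The first order part, at `z`, of the distance of the graph of `G α` to the graph of `G β`
translated by `(ε a, ε b)`. -/
noncomputable def defect (G : ℂ → ℂ → ℂ) (a b α₀ α β ε z : ℂ) : ℂ :=
  G β z - G α z + ε * (b - deriv (G α₀) z * a)

/-- There are pairs of graphs, as close to that of `G α₀` as one likes, which to first order are
translates of each other in the direction `(a, b)`. -/
def InfinitesimallyInvariant (T : Set ℂ) (δ : ℝ) (G : ℂ → ℂ → ℂ) (a b α₀ : ℂ) : Prop :=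
  ∃ α β ε : ℕ → ℂ, ConvergentPairs T α₀ α β ε ∧
    ∀ z ∈ ball (0 : ℂ) δ, (fun n => defect G a b α₀ (α n) (β n) (ε n) z) =o[atTop] ε

namespace LipFamily

variable {T : Set ℂ} {δ C : ℝ} {G : ℂ → ℂ → ℂ}

theorem norm_sub_sub_le (hG : LipFamily T δ C G) {α β : ℂ} (hα : α ∈ T) (hβ : β ∈ T) {R : ℝ}
    (hR : R < δ) {x y : ℂ} (hx : x ∈ closedBall 0 R) (hy : y ∈ closedBall 0 R) :
    ‖(G α x - G β x) - (G α y - G β y)‖ ≤ 2 * (C * ‖α - β‖) / (δ - R) * ‖x - y‖ :=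
  norm_sub_le_of_bounded ((hG.diff α hα).sub (hG.diff β hβ)) (hG.upper α hα β hβ) hR hx hy

theorem norm_deriv_sub_le (hG : LipFamily T δ C G) {α β : ℂ} (hα : α ∈ T) (hβ : β ∈ T) {R : ℝ}
    (hR : R < δ) {x : ℂ} (hx : x ∈ closedBall 0 R) :
    ‖deriv (G α) x - deriv (G β) x‖ ≤ 2 * (C * ‖α - β‖) / (δ - R) := by
  have hxδ := isOpen_ball.mem_nhds (closedBall_subset_ball hR hx)
  have h := norm_deriv_le_of_bounded ((hG.diff α hα).sub (hG.diff β hβ)) (hG.upper α hα β hβ) hR hx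
  rwa [deriv_sub ((hG.diff α hα).differentiableAt hxδ) ((hG.diff β hβ).differentiableAt hxδ)] at h

theorem tendsto_eval (hG : LipFamily T δ C G) {α₀ z : ℂ} (hα₀ : α₀ ∈ T) (hz : z ∈ ball 0 δ)
    {ι : Type*} {l : Filter ι} {α x : ι → ℂ} (hα : ∀ᶠ n in l, α n ∈ T) (tα : Tendsto α l (𝓝 α₀))
    (tx : Tendsto x l (𝓝 z)) : Tendsto (fun n => G (α n) (x n)) l (𝓝 (G α₀ z)) := by
  have h1 : Tendsto (fun n => G α₀ (x n)) l (𝓝 (G α₀ z)) :=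
    (((hG.diff α₀ hα₀).differentiableAt (isOpen_ball.mem_nhds hz)).continuousAt.tendsto).comp tx
  have h2 : Tendsto (fun n => G (α n) (x n) - G α₀ (x n)) l (𝓝 0) := by
    have h3 : Tendsto (fun n => C * ‖α n - α₀‖) l (𝓝 0) := by
      simpa using ((tα.sub_const α₀).norm).const_mul C
    refine squeeze_zero_norm' ?_ h3
    filter_upwards [hα, tx.eventually (isOpen_ball.mem_nhds hz)] with n hn hx
    exact hG.upper _ hn _ hα₀ _ hx
  simpa using h2.add h1

theorem tendsto_deriv (hG : LipFamily T δ C G) {α₀ z : ℂ} (hα₀ : α₀ ∈ T) (hz : z ∈ ball 0 δ)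
    {ι : Type*} {l : Filter ι} {α x : ι → ℂ} (hα : ∀ᶠ n in l, α n ∈ T) (tα : Tendsto α l (𝓝 α₀))
    (tx : Tendsto x l (𝓝 z)) : Tendsto (fun n => deriv (G (α n)) (x n)) l (𝓝 (deriv (G α₀) z)) := by
  obtain ⟨R, hzR, hR⟩ := exists_between (mem_ball.1 hz)
  have h1 : Tendsto (fun n => deriv (G α₀) (x n)) l (𝓝 (deriv (G α₀) z)) :=
    ((((hG.diff α₀ hα₀).deriv isOpen_ball).differentiableAt
      (isOpen_ball.mem_nhds hz)).continuousAt.tendsto).comp tx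
  have h2 : Tendsto (fun n => deriv (G (α n)) (x n) - deriv (G α₀) (x n)) l (𝓝 0) := by
    have h3 : Tendsto (fun n => 2 * (C * ‖α n - α₀‖) / (δ - R)) l (𝓝 0) := by
      simpa using ((((tα.sub_const α₀).norm).const_mul C).const_mul 2).div_const (δ - R)
    refine squeeze_zero_norm' ?_ h3
    filter_upwards [hα, tx.eventually (isOpen_ball.mem_nhds (mem_ball.2 hzR))] with n hn hx
    exact hG.norm_deriv_sub_le hn hα₀ hR (ball_subset_closedBall hx)
  simpa using h2.add h1

/-- `G α₀` is strictly differentiable at `z`, and by Cauchy's estimate `G (α n) - G α₀` is Lipschitz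
near `z` with a constant proportional to `‖α n - α₀‖`, which tends to `0`. -/
theorem isLittleO_increment (hG : LipFamily T δ C G) {α₀ z : ℂ} (hα₀ : α₀ ∈ T)
    (hz : z ∈ ball 0 δ) {α x y : ℕ → ℂ} (hα : ∀ᶠ n in atTop, α n ∈ T)
    (tα : Tendsto α atTop (𝓝 α₀)) (tx : Tendsto x atTop (𝓝 z)) (ty : Tendsto y atTop (𝓝 z)) :
    (fun n => G (α n) (x n) - G (α n) (y n) - deriv (G α₀) z * (x n - y n))
      =o[atTop] fun n => x n - y n := by
  obtain ⟨R, hzR, hR⟩ := exists_between (mem_ball.1 hz)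
  have hst : HasStrictDerivAt (G α₀) (deriv (G α₀) z) z :=
    ((hG.diff α₀ hα₀).analyticAt (isOpen_ball.mem_nhds hz)).hasStrictDerivAt
  have h1 := (hasStrictDerivAt_iff_hasStrictFDerivAt.1 hst).isLittleO.comp_tendsto
    (tx.prodMk_nhds ty)
  have h2 : (fun n => (G (α n) (x n) - G α₀ (x n)) - (G (α n) (y n) - G α₀ (y n)))
      =o[atTop] fun n => x n - y n := by
    have hO : (fun n => (G (α n) (x n) - G α₀ (x n)) - (G (α n) (y n) - G α₀ (y n)))
        =O[atTop] fun n => (α n - α₀) * (x n - y n) := by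
      refine IsBigO.of_bound (2 * C / (δ - R)) ?_
      filter_upwards [hα, tx.eventually (isOpen_ball.mem_nhds (mem_ball.2 hzR)),
        ty.eventually (isOpen_ball.mem_nhds (mem_ball.2 hzR))] with n hn hx hy
      refine (hG.norm_sub_sub_le hn hα₀ hR (ball_subset_closedBall hx)
        (ball_subset_closedBall hy)).trans (le_of_eq ?_)
      rw [norm_mul]
      ring
    refine hO.trans_isLittleO ?_
    have h0 : (fun n => α n - α₀) =o[atTop] fun _ => (1 : ℂ) := by
      rw [isLittleO_one_iff]
      simpa using tα.sub_const α₀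
    simpa using h0.mul_isBigO (isBigO_refl (fun n => x n - y n) atTop)
  refine (h2.add h1).congr (fun n => ?_) (fun n => rfl)
  simp [mul_comm]
  ring

/-- A small defect at a single point bounds `G β - G α` there by a multiple of `ε`, and the lower
Lipschitz bound passes this on to the parameters. -/
theorem isBigO_sub (hG : LipFamily T δ C G) {α₀ a b z : ℂ} (hz : z ∈ ball 0 δ) {α β ε : ℕ → ℂ}
    (hp : ConvergentPairs T α₀ α β ε)
    (hD : (fun n => defect G a b α₀ (α n) (β n) (ε n) z) =o[atTop] ε) :
    (fun n => β n - α n) =O[atTop] ε := by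
  have h1 : (fun n => G (β n) z - G (α n) z) =O[atTop] ε := by
    have h2 : (fun n => (b - deriv (G α₀) z * a) * ε n) =O[atTop] ε :=
      (isBigO_refl ε atTop).const_mul_left _
    refine (hD.isBigO.sub h2).congr_left fun n => ?_
    simp only [defect]
    ring
  refine IsBigO.trans (IsBigO.of_bound C ?_) h1
  filter_upwards [hp.mem_left, hp.mem_right] with n ha hb
  exact hG.lower _ hb _ ha _ hz

/-- Graphs which are nearly translates of each other at points tending to `z` have a small
defect at `z`. -/
theorem isLittleO_defect (hG : LipFamily T δ C G) {α₀ a b z : ℂ} (hα₀ : α₀ ∈ T) (hz : z ∈ ball 0 δ)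
    {α β ε ξ η : ℕ → ℂ} (hp : ConvergentPairs T α₀ α β ε) (tξ : Tendsto ξ atTop (𝓝 z))
    (tη : Tendsto η atTop (𝓝 z)) (h1 : (fun n => η n + ε n * a - ξ n) =o[atTop] ε)
    (h2 : (fun n => G (β n) (η n) + ε n * b - G (α n) (ξ n)) =o[atTop] ε) :
    (fun n => defect G a b α₀ (α n) (β n) (ε n) z) =o[atTop] ε := by
  obtain ⟨R, hzR, hR⟩ := exists_between (mem_ball.1 hz)
  have hzR' : z ∈ ball 0 R := mem_ball.2 hzR
  have hεa : ∀ c : ℂ, (fun n => ε n * c) =O[atTop] ε := fun c => by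
    simpa only [mul_comm] using (isBigO_refl ε atTop).const_mul_left c
  have hξη : (fun n => ξ n - η n) =O[atTop] ε :=
    ((hεa a).sub h1.isBigO).congr_left fun n => by ring
  have hinc := (hG.isLittleO_increment hα₀ hz hp.mem_left hp.left tξ tη).trans_isBigO hξη
  have hincO : (fun n => G (α n) (ξ n) - G (α n) (η n)) =O[atTop] ε :=
    (hinc.isBigO.add (hξη.const_mul_left (deriv (G α₀) z))).congr_left fun n => by ring
  have hdiff : (fun n => G (β n) (η n) - G (α n) (η n)) =O[atTop] ε :=
    ((h2.isBigO.sub (hεa b)).add hincO).congr_left fun n => by ring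
  have hβα : (fun n => β n - α n) =O[atTop] ε := by
    refine IsBigO.trans (IsBigO.of_bound C ?_) hdiff
    filter_upwards [hp.mem_left, hp.mem_right, tη.eventually (isOpen_ball.mem_nhds hz)]
      with n ha hb hη
    exact hG.lower _ hb _ ha _ hη
  -- Moving the evaluation point from `η n` to `z` costs `O(‖z - η n‖ ‖β n - α n‖)`, a product of a
  -- null sequence and of `O(ε)`.
  have hmove : (fun n => (G (β n) z - G (α n) z) - (G (β n) (η n) - G (α n) (η n)))
      =o[atTop] ε := by
    have hO : (fun n => (G (β n) z - G (α n) z) - (G (β n) (η n) - G (α n) (η n)))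
        =O[atTop] fun n => (z - η n) * (β n - α n) := by
      refine IsBigO.of_bound (2 * C / (δ - R)) ?_
      filter_upwards [hp.mem_left, hp.mem_right,
        tη.eventually (isOpen_ball.mem_nhds hzR')] with n ha hb hy
      refine (hG.norm_sub_sub_le hb ha hR (ball_subset_closedBall hzR')
        (ball_subset_closedBall hy)).trans (le_of_eq ?_)
      rw [norm_mul]
      ring
    refine hO.trans_isLittleO ?_
    have h0 : (fun n => z - η n) =o[atTop] fun _ => (1 : ℂ) := by
      rw [isLittleO_one_iff]
      simpa using tη.const_sub z
    simpa using h0.mul_isBigO hβα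
  have h3 := (((hmove.add h2).add hinc)).sub (h1.const_mul_left (deriv (G α₀) z))
  refine h3.congr_left fun n => ?_
  simp only [defect]
  ring

theorem exists_bound_deriv (hG : LipFamily T δ C G) {α₀ : ℂ} (hα₀ : α₀ ∈ T) {R : ℝ} (hR : R < δ) :
    ∃ K, 0 ≤ K ∧ ∀ z ∈ closedBall (0 : ℂ) R, ‖deriv (G α₀) z‖ ≤ K := by
  obtain ⟨K, hK⟩ := (isCompact_closedBall (0 : ℂ) R).exists_bound_of_continuousOn
    (((hG.diff α₀ hα₀).deriv isOpen_ball).continuousOn.mono (closedBall_subset_ball hR))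
  exact ⟨max K 0, le_max_right _ _, fun z hz => (hK z hz).trans (le_max_left _ _)⟩

/-- A small defect on a small disc implies a small defect on the whole disc. -/
theorem isLittleO_defect_of_ball (hG : LipFamily T δ C G) {α₀ a b z₀ : ℂ} (hα₀ : α₀ ∈ T)
    (hz₀ : z₀ ∈ ball 0 δ) {α β ε : ℕ → ℂ} (hp : ConvergentPairs T α₀ α β ε)
    (hD : ∀ᶠ z in 𝓝 z₀, (fun n => defect G a b α₀ (α n) (β n) (ε n) z) =o[atTop] ε) :
    ∀ z ∈ ball 0 δ, (fun n => defect G a b α₀ (α n) (β n) (ε n) z) =o[atTop] ε := by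
  have hO : (fun n => β n - α n) =O[atTop] ε := hG.isBigO_sub hz₀ hp hD.self_of_nhds
  obtain ⟨K, hK0, hK⟩ := hO.exists_pos
  have hKb := hK.bound
  have hiff : ∀ z, (fun n => defect G a b α₀ (α n) (β n) (ε n) z) =o[atTop] ε ↔
      Tendsto (fun n => defect G a b α₀ (α n) (β n) (ε n) z / ε n) atTop (𝓝 0) := by
    intro z
    refine isLittleO_iff_tendsto' ?_
    filter_upwards [hp.ne_zero] with n hn h0
    exact absurd h0 hn
  have hdiff : ∀ᶠ n in atTop, DifferentiableOn ℂ
      (fun z => defect G a b α₀ (α n) (β n) (ε n) z / ε n) (ball 0 δ) := by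
    filter_upwards [hp.mem_left, hp.mem_right] with n ha hb
    exact (((hG.diff _ hb).sub (hG.diff _ ha)).add (((differentiableOn_const _).sub
      (((hG.diff _ hα₀).deriv isOpen_ball).mul_const a)).const_mul _)).div_const _
  have hbound : ∀ R < δ, ∃ M, ∀ᶠ n in atTop, ∀ z ∈ ball (0 : ℂ) R,
      ‖defect G a b α₀ (α n) (β n) (ε n) z / ε n‖ ≤ M := by
    intro R hR
    obtain ⟨K', hK'0, hK'⟩ := hG.exists_bound_deriv hα₀ hR
    refine ⟨C * K + (‖b‖ + K' * ‖a‖), ?_⟩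
    filter_upwards [hp.mem_left, hp.mem_right, hp.ne_zero, hKb] with n ha hb hε hn z hz
    have hε' : 0 < ‖ε n‖ := norm_pos_iff.2 hε
    rw [norm_div, div_le_iff₀ hε']
    have h1 : ‖G (β n) z - G (α n) z‖ ≤ C * (K * ‖ε n‖) :=
      (hG.upper _ hb _ ha _ (ball_subset_ball hR.le hz)).trans
        (mul_le_mul_of_nonneg_left hn hG.pos.le)
    have h2 : ‖b - deriv (G α₀) z * a‖ ≤ ‖b‖ + K' * ‖a‖ := by
      refine (norm_sub_le _ _).trans ?_
      rw [norm_mul]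
      gcongr
      exact hK' z (ball_subset_closedBall hz)
    calc ‖defect G a b α₀ (α n) (β n) (ε n) z‖
        ≤ ‖G (β n) z - G (α n) z‖ + ‖ε n‖ * ‖b - deriv (G α₀) z * a‖ := by
          rw [← norm_mul]
          exact norm_add_le _ _
      _ ≤ C * (K * ‖ε n‖) + ‖ε n‖ * (‖b‖ + K' * ‖a‖) := by gcongr
      _ = _ := by ring
  -- The set `u` is open by definition. It is shown to be relatively closed in the disc, which is
  -- connected.
  set u : Set ℂ := {z | ∀ᶠ x in 𝓝 z, (fun n => defect G a b α₀ (α n) (β n) (ε n) x) =o[atTop] ε}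
    with hu
  have huo : IsOpen u := isOpen_setOfPred_eventually_nhds
  have hsub : ball 0 δ ⊆ u := by
    refine (convex_ball (0 : ℂ) δ).isPreconnected.subset_of_closure_inter_subset huo
      ⟨z₀, hz₀, hD⟩ ?_
    rintro z ⟨hzu, hz⟩
    obtain ⟨R, hzR, hR⟩ := exists_between (mem_ball.1 hz)
    have hd0 : 0 < (R - dist z 0) / 2 := by linarith
    -- With half of the room left inside radius `R`, the disc about `z₁` contains `z` and still lies
    -- in `ball 0 R`, where the quotients are bounded.
    obtain ⟨z₁, hz₁u, hz₁⟩ := Metric.mem_closure_iff.1 hzu _ hd0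
    obtain ⟨M, hM⟩ := hbound R hR
    obtain ⟨r, hr, hrz₁⟩ := Metric.mem_nhds_iff.1 (show _ ∈ 𝓝 z₁ from hz₁u)
    have hbs : ball z₁ ((R - dist z 0) / 2) ⊆ ball 0 R := by
      intro x hx
      have h1 := dist_triangle4 x z₁ z 0
      rw [dist_comm z₁ z] at h1
      rw [mem_ball] at *
      linarith
    have key := tendsto_zero_of_bounded (c := z₁) (R := (R - dist z 0) / 2) (M := M) hr
      (fun n z => defect G a b α₀ (α n) (β n) (ε n) z / ε n)
      (hdiff.mono fun n hn => hn.mono (hbs.trans (ball_subset_ball hR.le)))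
      (hM.mono fun n hn z hz => hn z (hbs hz))
      (fun x hx => (hiff x).1 (hrz₁ hx))
    filter_upwards [isOpen_ball.mem_nhds (mem_ball.2 hz₁)] with x hx
    exact (hiff x).2 (key x hx)
  exact fun z hz => (hsub hz).self_of_nhds

/-- Under infinitesimal invariance the size of the transversal component of `(a, b)` varies at most
by a constant factor along the graph. -/
theorem harnack (hG : LipFamily T δ C G) {α₀ a b : ℂ}
    (h : InfinitesimallyInvariant T δ G a b α₀) {z z' : ℂ} (hz : z ∈ ball 0 δ)
    (hz' : z' ∈ ball 0 δ) :
    ‖b - deriv (G α₀) z * a‖ ≤ C ^ 2 * ‖b - deriv (G α₀) z' * a‖ := by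
  obtain ⟨α, β, ε, hp, hD⟩ := h
  -- The quantity to be compared at two points is a limit of differences of graphs divided by `ε`;
  -- one factor `C` comes from the upper and one from the lower Lipschitz bound.
  have hlim : ∀ z ∈ ball (0 : ℂ) δ, Tendsto (fun n => ‖G (β n) z - G (α n) z‖ / ‖ε n‖) atTop
      (𝓝 ‖b - deriv (G α₀) z * a‖) := by
    intro z hz
    have h1 : Tendsto (fun n => defect G a b α₀ (α n) (β n) (ε n) z / ε n -
        (b - deriv (G α₀) z * a)) atTop (𝓝 (0 - (b - deriv (G α₀) z * a))) :=
      (hD z hz).tendsto_div_nhds_zero.sub_const _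
    have h2 := h1.norm
    rw [zero_sub, norm_neg] at h2
    refine h2.congr' ?_
    filter_upwards [hp.ne_zero] with n hn
    rw [← norm_div]
    congr 1
    simp only [defect]
    field_simp
    ring
  refine le_of_tendsto_of_tendsto (hlim z hz) ((hlim z' hz').const_mul (C ^ 2)) ?_
  filter_upwards [hp.mem_left, hp.mem_right] with n ha hb
  rw [← mul_div_assoc]
  gcongr
  calc ‖G (β n) z - G (α n) z‖ ≤ C * ‖β n - α n‖ := hG.upper _ hb _ ha _ hz
    _ ≤ C * (C * ‖G (β n) z' - G (α n) z'‖) :=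
      mul_le_mul_of_nonneg_left (hG.lower _ hb _ ha _ hz') hG.pos.le
    _ = _ := by ring

end LipFamily

/-! ### Counting the zeros of the gap -/

/-- The distance at `z` of the graph of `G α` to the graph of `G β` translated by `(ε a, ε b)`. -/
def translateGap (G : ℂ → ℂ → ℂ) (a b α β ε z : ℂ) : ℂ :=
  G β (z - ε * a) + ε * b - G α z

namespace LipFamily

variable {T : Set ℂ} {δ C : ℝ} {G : ℂ → ℂ → ℂ}

/-- Cauchy's estimate compares the derivative of `G α` with that of `G α₀`, so one constant serves
all parameters near `α₀`; the radius `1` is arbitrary. -/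
theorem exists_lipschitz (hG : LipFamily T δ C G) {α₀ : ℂ} (hα₀ : α₀ ∈ T) {R : ℝ} (hR : R < δ) :
    ∃ K, 0 ≤ K ∧ ∀ α ∈ T, ‖α - α₀‖ ≤ 1 → ∀ x ∈ closedBall (0 : ℂ) R, ∀ y ∈ closedBall (0 : ℂ) R,
      ‖G α x - G α y‖ ≤ K * ‖x - y‖ := by
  obtain ⟨K, hK0, hK⟩ := hG.exists_bound_deriv hα₀ hR
  have hC := hG.pos
  have hδR : 0 < δ - R := sub_pos.2 hR
  refine ⟨K + 2 * (C * 1) / (δ - R), by positivity, fun α hα hα1 x hx y hy => ?_⟩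
  refine (convex_closedBall (0 : ℂ) R).norm_image_sub_le_of_norm_deriv_le
    (fun z hz => (hG.diff α hα).differentiableAt
      (isOpen_ball.mem_nhds (closedBall_subset_ball hR hz))) (fun z hz => ?_) hy hx
  have h1 := hG.norm_deriv_sub_le hα hα₀ hR hz
  calc ‖deriv (G α) z‖ = ‖deriv (G α₀) z + (deriv (G α) z - deriv (G α₀) z)‖ := by congr 1; ring
    _ ≤ ‖deriv (G α₀) z‖ + ‖deriv (G α) z - deriv (G α₀) z‖ := norm_add_le _ _
    _ ≤ K + 2 * (C * ‖α - α₀‖) / (δ - R) := add_le_add (hK z hz) h1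
    _ ≤ _ := by gcongr

/-- The bound for the gap between a graph and a translate which meet. -/
theorem norm_translateGap_le (hG : LipFamily T δ C G) {a b α β ε p : ℂ} (hα : α ∈ T) (hβ : β ∈ T)
    {K R : ℝ} (hR : R < δ)
    (hK : ∀ x ∈ closedBall (0 : ℂ) R, ∀ y ∈ closedBall (0 : ℂ) R,
      ‖G α x - G α y‖ ≤ K * ‖x - y‖)
    (hp : p ∈ closedBall 0 R) (hp' : p - ε * a ∈ closedBall 0 R)
    (h0 : translateGap G a b α β ε p = 0) {z : ℂ} (hz : z ∈ closedBall 0 R)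
    (hz' : z - ε * a ∈ closedBall 0 R) :
    ‖translateGap G a b α β ε z‖ ≤ (C ^ 2 + 1) * (K * ‖a‖ + ‖b‖) * ‖ε‖ := by
  have hC := hG.pos
  have hinc : ∀ x, x ∈ closedBall (0 : ℂ) R → x - ε * a ∈ closedBall (0 : ℂ) R →
      ‖G α (x - ε * a) - G α x‖ ≤ K * (‖ε‖ * ‖a‖) := by
    intro x hx hx'
    refine (hK _ hx' _ hx).trans (le_of_eq ?_)
    rw [show x - ε * a - x = -(ε * a) by ring, norm_neg, norm_mul]
  have hdec : ∀ x, translateGap G a b α β ε x =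
      (G β (x - ε * a) - G α (x - ε * a)) + ((G α (x - ε * a) - G α x) + ε * b) := by
    intro x
    simp only [translateGap]
    ring
  have hrest : ∀ x, x ∈ closedBall (0 : ℂ) R → x - ε * a ∈ closedBall (0 : ℂ) R →
      ‖(G α (x - ε * a) - G α x) + ε * b‖ ≤ (K * ‖a‖ + ‖b‖) * ‖ε‖ := by
    intro x hx hx'
    refine (norm_add_le _ _).trans ?_
    rw [norm_mul]
    linarith [hinc x hx hx']
  -- At the zero `p` the difference of the two graphs equals an increment of order `ε`, so the
  -- parameters are `O(ε)`-close.
  have hβα : ‖β - α‖ ≤ C * ((K * ‖a‖ + ‖b‖) * ‖ε‖) := by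
    refine (hG.lower _ hβ _ hα _ (closedBall_subset_ball hR hp')).trans
      (mul_le_mul_of_nonneg_left ?_ hC.le)
    rw [hdec p] at h0
    rw [eq_neg_of_add_eq_zero_left h0, norm_neg]
    exact hrest p hp hp'
  rw [hdec z]
  calc _ ≤ ‖G β (z - ε * a) - G α (z - ε * a)‖ + ‖(G α (z - ε * a) - G α z) + ε * b‖ :=
        norm_add_le _ _
    _ ≤ C * (C * ((K * ‖a‖ + ‖b‖) * ‖ε‖)) + (K * ‖a‖ + ‖b‖) * ‖ε‖ :=
        add_le_add ((hG.upper _ hβ _ hα _ (closedBall_subset_ball hR hz')).trans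
          (mul_le_mul_of_nonneg_left hβα hC.le)) (hrest z hz hz')
    _ = _ := by ring

theorem differentiableOn_translateGap (hG : LipFamily T δ C G) {a b α β ε c : ℂ} (hα : α ∈ T)
    (hβ : β ∈ T) {r : ℝ} (h : ∀ z ∈ ball c r, z ∈ ball 0 δ ∧ z - ε * a ∈ ball 0 δ) :
    DifferentiableOn ℂ (translateGap G a b α β ε) (ball c r) := by
  unfold translateGap
  refine ((DifferentiableOn.comp (hG.diff β hβ) (differentiableOn_id.sub_const _)
    fun z hz => (h z hz).2).add_const _).sub ((hG.diff α hα).mono fun z hz => (h z hz).1)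

/-- If no bound holds near `c`, a gap of order `ε` acquires arbitrarily many zeros close to `c` and
is therefore `o(ε)` on a fixed disc about `c`; this yields the invariance of `α₀`. -/
theorem exists_bound_zeros_nhds (hG : LipFamily T δ C G) {α₀ a b : ℂ} (hα₀ : α₀ ∈ T)
    (h : ¬ InfinitesimallyInvariant T δ G a b α₀) {c : ℂ} (hc : c ∈ ball 0 δ) :
    ∃ ρ : ℝ, 0 < ρ ∧ ∃ N : ℕ, ∀ α ∈ T, ∀ β ∈ T, ∀ ε : ℂ, ‖α - α₀‖ < ρ → ‖β - α₀‖ < ρ →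
      0 < ‖ε‖ → ‖ε‖ < ρ → {z ∈ ball c ρ | translateGap G a b α β ε z = 0}.encard ≤ N := by
  by_contra! hcon
  apply h
  have hpos : ∀ n : ℕ, (0 : ℝ) < 1 / ((n : ℝ) + 1) := fun n => Nat.one_div_pos_of_nat
  -- The index `n` sets both the radius `1 / (n + 1)` and the number of zeros.
  choose α hαT β hβT ε hα hβ hε0 hε hcard using fun n : ℕ => hcon (1 / ((n : ℝ) + 1)) (hpos n) n
  have tρ : Tendsto (fun n : ℕ => 1 / ((n : ℝ) + 1)) atTop (𝓝 0) :=
    tendsto_one_div_add_atTop_nhds_zero_nat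
  have hlim : ∀ x : ℕ → ℂ, ∀ x₀, (∀ n : ℕ, ‖x n - x₀‖ < 1 / ((n : ℝ) + 1)) →
      Tendsto x atTop (𝓝 x₀) := by
    intro x x₀ hx
    rw [tendsto_iff_norm_sub_tendsto_zero]
    exact squeeze_zero (fun _ => norm_nonneg _) (fun n => (hx n).le) tρ
  have hp : ConvergentPairs T α₀ α β ε :=
    ⟨.of_forall hαT, .of_forall hβT, .of_forall fun n => norm_pos_iff.1 (hε0 n), hlim _ _ hα,
      hlim _ _ hβ, hlim _ _ fun n => by simpa using hε n⟩
  refine ⟨α, β, ε, hp, hG.isLittleO_defect_of_ball hα₀ hc hp ?_⟩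
  obtain ⟨R, hcR, hR⟩ := exists_between (mem_ball.1 hc)
  obtain ⟨K, hK0, hK⟩ := hG.exists_lipschitz hα₀ hR
  set r := (R - dist c 0) / 2 with hr
  have hr0 : 0 < r := by rw [hr]; linarith
  set M := (C ^ 2 + 1) * (K * ‖a‖ + ‖b‖) with hM
  have tεa : Tendsto (fun n => ‖ε n * a‖) atTop (𝓝 0) := by
    simpa using (hp.zero.mul_const a).norm
  have hgap : ∀ᶠ n : ℕ in atTop, ∀ z ∈ ball c (r / 4),
      ‖translateGap G a b (α n) (β n) (ε n) z‖ ≤ M * ‖ε n‖ * (2 / 3) ^ n := by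
    filter_upwards [tρ.eventually (gt_mem_nhds (show 0 < r / 4 by positivity)),
      tεa.eventually (gt_mem_nhds hr0), eventually_ge_atTop 1] with n hn hεa hn1 z hz
    have hin : ∀ z ∈ ball c r, z ∈ closedBall (0 : ℂ) R ∧ z - ε n * a ∈ closedBall (0 : ℂ) R := by
      intro z hz
      have h1 := dist_triangle z c 0
      have h2 : ‖z - ε n * a‖ ≤ ‖z‖ + ‖ε n * a‖ := norm_sub_le _ _
      rw [mem_ball] at hz
      simp only [mem_closedBall, dist_zero_right] at *
      constructor <;> linarith
    obtain ⟨s, hs, hscard⟩ := Set.exists_subset_encard_eq (hcard n).le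
    have hsfin : s.Finite := Set.finite_of_encard_eq_coe hscard
    have hs' : ∀ p ∈ hsfin.toFinset, p ∈ ball c (r / 4) ∧
        translateGap G a b (α n) (β n) (ε n) p = 0 := by
      intro p hp
      have := hs (hsfin.mem_toFinset.1 hp)
      exact ⟨ball_subset_ball hn.le this.1, this.2⟩
    have hcards : hsfin.toFinset.card = n := by
      rw [hsfin.encard_eq_coe_toFinset_card] at hscard
      exact_mod_cast hscard
    obtain ⟨p, hp⟩ : hsfin.toFinset.Nonempty := by
      rw [← Finset.card_pos, hcards]
      exact hn1
    have hp1 := hin p (ball_subset_ball (by linarith) (hs' p hp).1)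
    have hα1 : ‖α n - α₀‖ ≤ 1 := by
      refine (hα n).le.trans ?_
      rw [div_le_one (by positivity)]
      linarith [(Nat.cast_nonneg n : (0 : ℝ) ≤ n)]
    have hb : ∀ z ∈ ball c r, ‖translateGap G a b (α n) (β n) (ε n) z‖ ≤ M * ‖ε n‖ := by
      intro z hz
      exact hG.norm_translateGap_le (hαT n) (hβT n) hR (hK _ (hαT n) hα1) hp1.1 hp1.2
        (hs' p hp).2 (hin z hz).1 (hin z hz).2
    have hd : DifferentiableOn ℂ (translateGap G a b (α n) (β n) (ε n)) (ball c r) :=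
      hG.differentiableOn_translateGap (hαT n) (hβT n) fun z hz =>
        ⟨closedBall_subset_ball hR (hin z hz).1, closedBall_subset_ball hR (hin z hz).2⟩
    -- Zeros in the disc of radius `r / 4` inside one of radius `r` give the ratio `2 (r / 4) / (r -
    -- r / 4) = 2 / 3 < 1`.
    have key := norm_le_of_zeros (by linarith : r / 4 < r) hsfin.toFinset _ _ hd hb hs' z hz
    rwa [hcards, show 2 * (r / 4) / (r - r / 4) = 2 / 3 by field_simp; norm_num] at key
  filter_upwards [isOpen_ball.mem_nhds (mem_ball_self (show 0 < r / 4 by positivity)),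
    isOpen_ball.mem_nhds hc] with z hz hzδ
  -- With these points the coordinates along the plaque match exactly, and the transversal error is
  -- the gap itself.
  refine hG.isLittleO_defect hα₀ hzδ hp (ξ := fun _ => z) (η := fun n => z - ε n * a)
    tendsto_const_nhds (by simpa using (hp.zero.mul_const a).const_sub z) ?_ ?_
  · refine (isLittleO_zero ε atTop).congr_left fun n => ?_
    ring
  · have h1 : (fun n => translateGap G a b (α n) (β n) (ε n) z) =O[atTop]
        fun n => ε n * (2 / 3 : ℂ) ^ n := by
      refine IsBigO.of_bound M ?_
      filter_upwards [hgap] with n hn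
      refine (hn z hz).trans (le_of_eq ?_)
      rw [norm_mul, norm_pow]
      norm_num
      ring
    refine h1.trans_isLittleO ?_
    have h0 : (fun n : ℕ => (2 / 3 : ℂ) ^ n) =o[atTop] fun _ => (1 : ℂ) := by
      rw [isLittleO_one_iff]
      exact tendsto_pow_atTop_nhds_zero_of_norm_lt_one (by norm_num)
    simpa using (isBigO_refl ε atTop).mul_isLittleO h0

/-- Unless the graph of `G α₀` is infinitesimally invariant, the number of points in which a graph
near it meets a small translate of another one is bounded. -/
theorem exists_bound_zeros (hG : LipFamily T δ C G) {α₀ a b : ℂ} (hα₀ : α₀ ∈ T)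
    (h : ¬ InfinitesimallyInvariant T δ G a b α₀) {R : ℝ} (hR : R < δ) :
    ∃ ρ : ℝ, 0 < ρ ∧ ∃ N : ℕ, ∀ α ∈ T, ∀ β ∈ T, ∀ ε : ℂ, ‖α - α₀‖ < ρ → ‖β - α₀‖ < ρ →
      0 < ‖ε‖ → ‖ε‖ < ρ →
      {z ∈ closedBall (0 : ℂ) R | translateGap G a b α β ε z = 0}.encard ≤ N := by
  refine (isCompact_closedBall (0 : ℂ) R).induction_on
    (p := fun s => ∃ ρ : ℝ, 0 < ρ ∧ ∃ N : ℕ, ∀ α ∈ T, ∀ β ∈ T, ∀ ε : ℂ, ‖α - α₀‖ < ρ →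
      ‖β - α₀‖ < ρ → 0 < ‖ε‖ → ‖ε‖ < ρ →
      {z ∈ s | translateGap G a b α β ε z = 0}.encard ≤ N) ?_ ?_ ?_ ?_
  · exact ⟨1, one_pos, 0, by simp⟩
  · rintro s t hst ⟨ρ, hρ, N, hN⟩
    refine ⟨ρ, hρ, N, fun α hα β hβ ε h1 h2 h3 h4 => le_trans ?_ (hN α hα β hβ ε h1 h2 h3 h4)⟩
    exact Set.encard_le_encard fun z hz => ⟨hst hz.1, hz.2⟩
  · rintro s t ⟨ρ, hρ, N, hN⟩ ⟨ρ', hρ', N', hN'⟩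
    refine ⟨min ρ ρ', lt_min hρ hρ', N + N', fun α hα β hβ ε h1 h2 h3 h4 => ?_⟩
    rw [lt_min_iff] at h1 h2 h4
    rw [Nat.cast_add]
    refine le_trans ?_ (add_le_add (hN α hα β hβ ε h1.1 h2.1 h3 h4.1)
      (hN' α hα β hβ ε h1.2 h2.2 h3 h4.2))
    refine le_trans (Set.encard_le_encard ?_) (Set.encard_union_le _ _)
    rintro z ⟨hz | hz, hz'⟩
    · exact Or.inl ⟨hz, hz'⟩
    · exact Or.inr ⟨hz, hz'⟩
  · intro c hc
    obtain ⟨ρ, hρ, N, hN⟩ := hG.exists_bound_zeros_nhds hα₀ h (closedBall_subset_ball hR hc)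
    exact ⟨ball c ρ, mem_nhdsWithin_of_mem_nhds (ball_mem_nhds c hρ), ρ, hρ, N, hN⟩

end LipFamily

/-! ### Exchange of coordinates and the lattice -/

namespace Direction

@[simp] theorem place_place (d : Direction) (q : ℂ × ℂ) : d.place (d.place q) = q := by
  cases d <;> rfl

theorem place_add (d : Direction) (p q : ℂ × ℂ) : d.place (p + q) = d.place p + d.place q := by
  cases d <;> rfl

theorem place_sub (d : Direction) (p q : ℂ × ℂ) : d.place (p - q) = d.place p - d.place q := by
  cases d <;> rfl

theorem place_smul (d : Direction) (c : ℂ) (q : ℂ × ℂ) : d.place (c • q) = c • d.place q := by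
  cases d <;> rfl

theorem norm_place (d : Direction) (q : ℂ × ℂ) : ‖d.place q‖ = ‖q‖ := by
  cases d
  · rfl
  · simp [place, Prod.norm_def, max_comm]

theorem continuous_place (d : Direction) : Continuous d.place := by
  cases d
  · exact continuous_id
  · exact continuous_swap

theorem place_eq_iff (d : Direction) {p q : ℂ × ℂ} : d.place p = q ↔ p = d.place q :=
  ⟨fun h => by rw [← h, place_place], fun h => by rw [h, place_place]⟩

end Direction

theorem mkQ_eq_iff {Λ : Submodule ℤ (ℂ × ℂ)} {p q : ℂ × ℂ} :
    Λ.mkQ p = Λ.mkQ q ↔ ∃ l ∈ Λ, p + l = q := by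
  rw [Submodule.mkQ_apply, Submodule.mkQ_apply, eq_comm, Submodule.Quotient.eq]
  exact ⟨fun h => ⟨q - p, h, by abel⟩, fun ⟨l, hl, h⟩ => by rwa [← h, add_sub_cancel_left]⟩

theorem mkQ_add_mem {Λ : Submodule ℤ (ℂ × ℂ)} {p l : ℂ × ℂ} (hl : l ∈ Λ) :
    Λ.mkQ (p + l) = Λ.mkQ p :=
  (mkQ_eq_iff.2 ⟨l, hl, rfl⟩).symm

/-! ### Charts and compatibility of flow boxes -/

namespace FlowBox

variable {Λ : Submodule ℤ (ℂ × ℂ)} {X : Set ((ℂ × ℂ) ⧸ Λ)}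

/-- The functions whose graphs are the plaques, normalized by their value `w` at `0`. -/
def graph (B : FlowBox Λ X) (w z : ℂ) : ℂ := w + B.f w z

/-- The coordinate of a point along the plaques of a flow box. -/
def coord (B : FlowBox Λ X) (q : ℂ × ℂ) : ℂ := (B.dir.place q).1 - B.base

theorem chart_eq (B : FlowBox Λ X) (z w : ℂ) :
    B.chart z w = B.dir.place (B.base + z, B.graph w z) := rfl

theorem place_chart (B : FlowBox Λ X) (z w : ℂ) :
    B.dir.place (B.chart z w) = (B.base + z, B.graph w z) := by
  rw [chart_eq, Direction.place_place]

@[simp] theorem coord_chart (B : FlowBox Λ X) (z w : ℂ) : B.coord (B.chart z w) = z := by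
  rw [coord, place_chart, add_sub_cancel_left]

theorem continuous_coord (B : FlowBox Λ X) : Continuous B.coord :=
  (continuous_fst.comp B.dir.continuous_place).sub continuous_const

theorem chart_mem (B : FlowBox Λ X) {z w : ℂ} (hz : z ∈ ball 0 B.δ) (hw : w ∈ B.T) :
    B.chart z w ∈ Λ.mkQ ⁻¹' X ∩ B.U := by
  rw [← B.image_eq]
  exact ⟨(z, w), ⟨hz, hw⟩, rfl⟩

theorem exists_chart_eq (B : FlowBox Λ X) {q : ℂ × ℂ} (hX : Λ.mkQ q ∈ X) (hq : q ∈ B.U) :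
    ∃ z ∈ ball 0 B.δ, ∃ w ∈ B.T, B.chart z w = q := by
  have h : q ∈ Λ.mkQ ⁻¹' X ∩ B.U := ⟨hX, hq⟩
  rw [← B.image_eq] at h
  obtain ⟨⟨z, w⟩, ⟨hz, hw⟩, h⟩ := h
  exact ⟨z, hz, w, hw, h⟩

theorem chart_inj (B : FlowBox Λ X) {z w z' w' : ℂ} (hz : z ∈ ball 0 B.δ) (hw : w ∈ B.T)
    (hz' : z' ∈ ball 0 B.δ) (hw' : w' ∈ B.T) (h : B.chart z w = B.chart z' w') :
    z = z' ∧ w = w' := by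
  have := @B.isEmbedding.injective ⟨(z, w), hz, hw⟩ ⟨(z', w'), hz', hw'⟩ h
  exact Prod.ext_iff.1 (Subtype.ext_iff.1 this)

theorem graph_differentiableOn (B : FlowBox Λ X) {w : ℂ} (hw : w ∈ B.T) :
    DifferentiableOn ℂ (B.graph w) (ball 0 B.δ) :=
  (B.holo w hw).const_add w

theorem continuousAt_chart (B : FlowBox Λ X) {z w : ℂ} (hz : z ∈ ball 0 B.δ) (hw : w ∈ B.T) :
    ContinuousAt (fun x => B.chart x w) z :=
  B.dir.continuous_place.continuousAt.comp ((continuousAt_const.add continuousAt_id).prodMk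
    ((B.graph_differentiableOn hw).differentiableAt (isOpen_ball.mem_nhds hz)).continuousAt)

/-- Two plaques of boxes which meet openly coincide, up to a lattice vector, near a common point. -/
theorem MeetsOpenly.eventually {B B' : FlowBox Λ X} (h : B.MeetsOpenly B') {z₀ w z₀' w' : ℂ}
    (hz₀ : z₀ ∈ ball 0 B.δ) (hw : w ∈ B.T) (hz₀' : z₀' ∈ ball 0 B'.δ) (hw' : w' ∈ B'.T)
    {l : ℂ × ℂ} (hl : l ∈ Λ) (he : B.chart z₀ w + l = B'.chart z₀' w') :
    ∀ᶠ z in 𝓝 z₀, z ∈ ball 0 B.δ ∧ B'.coord (B.chart z w + l) ∈ ball 0 B'.δ ∧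
      B'.chart (B'.coord (B.chart z w + l)) w' = B.chart z w + l := by
  have hmem : z₀ ∈ {z ∈ ball (0 : ℂ) B.δ | Λ.mkQ (B.chart z w) ∈ Λ.mkQ '' B'.plaque w'} := by
    refine ⟨hz₀, B'.chart z₀' w', ⟨z₀', hz₀', rfl⟩, ?_⟩
    rw [← he, mkQ_add_mem hl]
  have hU : ∀ᶠ z in 𝓝 z₀, B.chart z w + l ∈ B'.U := by
    refine ((B.continuousAt_chart hz₀ hw).add continuousAt_const).eventually_mem
      (B'.isOpen_U.mem_nhds ?_)
    change B.chart z₀ w + l ∈ B'.U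
    rw [he]
    exact (B'.chart_mem hz₀' hw').2
  filter_upwards [(h w hw w' hw').mem_nhds hmem, hU] with z hz hzU
  obtain ⟨hzb, _, ⟨z', hz', rfl⟩, hq⟩ := hz
  have heq : B'.chart z' w' = B.chart z w + l :=
    B'.injOn_U (B'.chart_mem hz' hw').2 hzU (by rw [mkQ_add_mem hl]; exact hq)
  rw [← heq, coord_chart]
  exact ⟨hzb, hz', rfl⟩

theorem meetsOpenly_of_eventually {B B' : FlowBox Λ X}
    (h : ∀ z₀ ∈ ball 0 B.δ, ∀ w ∈ B.T, ∀ z₀' ∈ ball 0 B'.δ, ∀ w' ∈ B'.T, ∀ l ∈ Λ,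
      B.chart z₀ w + l = B'.chart z₀' w' →
      ∀ᶠ z in 𝓝 z₀, ∃ z' ∈ ball 0 B'.δ, B'.chart z' w' = B.chart z w + l) :
    B.MeetsOpenly B' := by
  intro w hw w' hw'
  rw [isOpen_iff_mem_nhds]
  rintro z₀ ⟨hz₀, _, ⟨z₀', hz₀', rfl⟩, hq⟩
  obtain ⟨l, hl, he⟩ := mkQ_eq_iff.1 hq.symm
  filter_upwards [isOpen_ball.mem_nhds hz₀, h z₀ hz₀ w hw z₀' hz₀' w' hw' l hl he] with z hz hz'
  obtain ⟨z', hz', he'⟩ := hz'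
  refine ⟨hz, _, ⟨z', hz', rfl⟩, ?_⟩
  change Λ.mkQ (B'.chart z' w') = _
  rw [he', mkQ_add_mem hl]

end FlowBox

variable {Λ : Submodule ℤ (ℂ × ℂ)} {L : TorusLamination Λ}

/-- Membership in the maximal atlas only refers to boxes of the given atlas. Near a common point the
plaques are compared through a box of the atlas that covers it, up to lattice vectors. -/
theorem IsFlowBox.meetsOpenly {B B' : FlowBox Λ L.carrier} (hB : L.IsFlowBox B)
    (hB' : L.IsFlowBox B') : B.MeetsOpenly B' := by
  refine FlowBox.meetsOpenly_of_eventually fun z₀ hz₀ w hw z₀' hz₀' w' hw' l hl he => ?_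
  have hX := (B'.chart_mem hz₀' hw').1
  obtain ⟨B₀, hB₀, q, hqU, hq⟩ := mem_iUnion₂.1 (L.covers hX)
  obtain ⟨ζ₀, hζ₀, w₀, hw₀, rfl⟩ := B₀.exists_chart_eq
    (by rw [hq]; exact hX) hqU
  obtain ⟨m, hm, he'⟩ := mkQ_eq_iff.1 hq
  have he1 : B.chart z₀ w + (l - m) = B₀.chart ζ₀ w₀ := by
    rw [← add_sub_assoc, he, ← he', add_sub_cancel_right]
  have h1 := (hB B₀ hB₀).1.eventually hz₀ hw hζ₀ hw₀ (Λ.sub_mem hl hm) he1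
  have h2 := (hB' B₀ hB₀).2.eventually hζ₀ hw₀ hz₀' hw' hm he'
  have hc : ContinuousAt (fun z => B₀.coord (B.chart z w + (l - m))) z₀ :=
    B₀.continuous_coord.continuousAt.comp
      ((B.continuousAt_chart hz₀ hw).add continuousAt_const)
  have h3 : Tendsto (fun z => B₀.coord (B.chart z w + (l - m))) (𝓝 z₀) (𝓝 ζ₀) := by
    have := hc.tendsto
    rwa [he1, FlowBox.coord_chart] at this
  filter_upwards [h1, h3.eventually h2] with z hz1 hz2
  refine ⟨_, hz2.2.1, hz2.2.2.trans ?_⟩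
  rw [hz1.2.2]
  abel

namespace FlowBox

variable {X : Set ((ℂ × ℂ) ⧸ Λ)}

theorem IsLipschitz.lipFamily {B : FlowBox Λ X} (h : B.IsLipschitz) :
    ∃ C, LipFamily B.T B.δ C B.graph := by
  obtain ⟨C, hC, h⟩ := h
  refine ⟨C, hC, fun w hw => B.graph_differentiableOn hw, fun α hα β hβ z hz => ?_,
    fun α hα β hβ z hz => (h α hα β hβ z hz).2⟩
  have := (h α hα β hβ z hz).1
  rw [div_le_iff₀ hC, mul_comm] at this
  exact this

end FlowBox

/-! ### Invariance under change of flow box -/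

/-- Graphs with a small defect are translates of each other to first order. -/
theorem LipFamily.isLittleO_translateGap {T : Set ℂ} {δ C : ℝ} {G : ℂ → ℂ → ℂ}
    (hG : LipFamily T δ C G) {α₀ a b z : ℂ} (hα₀ : α₀ ∈ T) (hz : z ∈ ball 0 δ) {α β ε : ℕ → ℂ}
    (hp : ConvergentPairs T α₀ α β ε)
    (hD : (fun n => defect G a b α₀ (α n) (β n) (ε n) z) =o[atTop] ε) :
    (fun n => translateGap G a b (α n) (β n) (ε n) z) =o[atTop] ε := by
  have t : Tendsto (fun n => z - ε n * a) atTop (𝓝 z) := by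
    simpa using (hp.zero.mul_const a).const_sub z
  have h1 := hG.isLittleO_increment hα₀ hz hp.mem_right hp.right t tendsto_const_nhds
  have h2 : (fun n => z - ε n * a - z) =O[atTop] ε := by
    refine ((isBigO_refl ε atTop).const_mul_left (-a)).congr_left fun n => ?_
    ring
  refine (hD.add (h1.trans_isBigO h2)).congr_left fun n => ?_
  simp only [defect, translateGap]
  ring

namespace FlowBox

variable {X : Set ((ℂ × ℂ) ⧸ Λ)}

theorem tendsto_chart {B : FlowBox Λ X} {C : ℝ} (hG : LipFamily B.T B.δ C B.graph) {z₀ α₀ : ℂ}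
    (hz₀ : z₀ ∈ ball 0 B.δ) (hα₀ : α₀ ∈ B.T) {ι : Type*} {l : Filter ι} {z α : ι → ℂ}
    (hα : ∀ᶠ n in l, α n ∈ B.T) (tα : Tendsto α l (𝓝 α₀)) (tz : Tendsto z l (𝓝 z₀)) :
    Tendsto (fun n => B.chart (z n) (α n)) l (𝓝 (B.chart z₀ α₀)) :=
  (B.dir.continuous_place.tendsto _).comp
    ((tz.const_add B.base).prodMk_nhds (hG.tendsto_eval hα₀ hz₀ hα tα tz))

/-- The points of a convergent sequence lie on plaques whose parameters converge. -/
theorem tendsto_of_tendsto_chart {B : FlowBox Λ X} {C : ℝ} (hG : LipFamily B.T B.δ C B.graph)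
    {z₀ α₀ : ℂ} (hz₀ : z₀ ∈ ball 0 B.δ) (hα₀ : α₀ ∈ B.T) {ι : Type*} {l : Filter ι} {z α : ι → ℂ}
    (hα : ∀ᶠ n in l, α n ∈ B.T)
    (t : Tendsto (fun n => B.chart (z n) (α n)) l (𝓝 (B.chart z₀ α₀))) :
    Tendsto z l (𝓝 z₀) ∧ Tendsto α l (𝓝 α₀) := by
  have tz : Tendsto z l (𝓝 z₀) := by
    simpa [Function.comp_def] using (B.continuous_coord.tendsto _).comp t
  refine ⟨tz, ?_⟩
  have h1 : Tendsto (fun n => B.graph (α n) (z n)) l (𝓝 (B.graph α₀ z₀)) := by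
    have := (continuous_snd.tendsto _).comp ((B.dir.continuous_place.tendsto _).comp t)
    simpa [Function.comp_def, place_chart] using this
  have h2 : Tendsto (fun n => B.graph α₀ (z n)) l (𝓝 (B.graph α₀ z₀)) :=
    hG.tendsto_eval hα₀ hz₀ (.of_forall fun _ => hα₀) tendsto_const_nhds tz
  rw [tendsto_iff_norm_sub_tendsto_zero]
  have h3 : Tendsto (fun n => C * ‖B.graph (α n) (z n) - B.graph α₀ (z n)‖) l (𝓝 0) := by
    simpa using ((h1.sub h2).norm).const_mul C
  refine squeeze_zero_norm' ?_ h3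
  filter_upwards [hα, tz.eventually (isOpen_ball.mem_nhds hz₀)] with n hn hz
  rw [norm_norm]
  exact hG.lower _ hn _ hα₀ _ hz

/-- Near a common point the plaques of a flow box are contained in plaques of another one. -/
theorem MeetsOpenly.exists_plaque_map {B B' : FlowBox Λ X} (h : B.MeetsOpenly B') {C : ℝ}
    (hG : LipFamily B.T B.δ C B.graph) {z₀ α₀ z₀' α₀' : ℂ}
    (hz₀ : z₀ ∈ ball 0 B.δ) (hα₀ : α₀ ∈ B.T) (hz₀' : z₀' ∈ ball 0 B'.δ) (hα₀' : α₀' ∈ B'.T)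
    {l : ℂ × ℂ} (hl : l ∈ Λ) (he : B.chart z₀ α₀ + l = B'.chart z₀' α₀') :
    ∃ r : ℝ, 0 < r ∧ ∃ φ : ℂ → ℂ, ∀ᶠ α in 𝓝[B.T] α₀, φ α ∈ B'.T ∧ ∀ z ∈ ball z₀ r,
      z ∈ ball 0 B.δ ∧ B'.coord (B.chart z α + l) ∈ ball 0 B'.δ ∧
        B'.chart (B'.coord (B.chart z α + l)) (φ α) = B.chart z α + l := by
  have hT : ∀ᶠ α in 𝓝[B.T] α₀, α ∈ B.T := eventually_mem_nhdsWithin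
  have t : Tendsto (fun p : ℂ × ℂ => B.chart p.1 p.2 + l) (𝓝 z₀ ×ˢ 𝓝[B.T] α₀)
      (𝓝 (B.chart z₀ α₀ + l)) :=
    (tendsto_chart hG hz₀ hα₀ (tendsto_snd.eventually hT)
      (tendsto_snd.mono_right nhdsWithin_le_nhds) tendsto_fst).add_const l
  rw [he] at t
  have hU := t.eventually (B'.isOpen_U.mem_nhds (B'.chart_mem hz₀' hα₀').2)
  have hb : ∀ᶠ p : ℂ × ℂ in 𝓝 z₀ ×ˢ 𝓝[B.T] α₀, p.1 ∈ ball 0 B.δ :=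
    tendsto_fst.eventually (isOpen_ball.mem_nhds hz₀)
  obtain ⟨pa, hpa, pb, hpb, hab⟩ := eventually_prod_iff.1 (hU.and hb)
  obtain ⟨r, hr, hrpa⟩ := Metric.mem_nhds_iff.1 hpa
  have hmain : ∀ α, α ∈ B.T → pb α → ∃ α' ∈ B'.T, ∀ z ∈ ball z₀ r, ∃ z' ∈ ball 0 B'.δ,
      B'.chart z' α' = B.chart z α + l := by
    intro α hα hpα
    have hex : ∀ z ∈ ball z₀ r, ∃ z' ∈ ball 0 B'.δ, ∃ α' ∈ B'.T,
        B'.chart z' α' = B.chart z α + l := by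
      intro z hz
      have h1 := hab (hrpa hz) hpα
      refine B'.exists_chart_eq ?_ h1.1
      rw [mkQ_add_mem hl]
      exact (B.chart_mem h1.2 hα).1
    obtain ⟨ζ₀, hζ₀, α', hα', he₀⟩ := hex z₀ (mem_ball_self hr)
    have hopen : ∀ z ∈ ball z₀ r, ∀ α'' ∈ B'.T, (∃ z' ∈ ball 0 B'.δ,
        B'.chart z' α'' = B.chart z α + l) → ∀ᶠ x in 𝓝 z, ∃ z' ∈ ball 0 B'.δ,
        B'.chart z' α'' = B.chart x α + l := by
      rintro z hz α'' hα'' ⟨z', hz', he'⟩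
      filter_upwards [h.eventually (hab (hrpa hz) hpα).2 hα hz' hα'' hl he'.symm] with x hx
      exact ⟨_, hx.2.1, hx.2.2⟩
    refine ⟨α', hα', ?_⟩
    -- Open meeting makes the parameter in `B'` locally constant along the plaque, hence constant on
    -- the connected disc. At a limit point of `u` the parameters `α''` and `α'` share a nearby
    -- point, so they agree.
    set u : Set ℂ := {z | z ∈ ball z₀ r ∧ ∃ z' ∈ ball 0 B'.δ, B'.chart z' α' = B.chart z α + l}
      with hu
    have huo : IsOpen u := by
      rw [isOpen_iff_mem_nhds]
      rintro z ⟨hz, hz'⟩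
      filter_upwards [isOpen_ball.mem_nhds hz, hopen z hz α' hα' hz'] with x hx hx'
      exact ⟨hx, hx'⟩
    have hsub : ball z₀ r ⊆ u := by
      refine (convex_ball z₀ r).isPreconnected.subset_of_closure_inter_subset huo
        ⟨z₀, mem_ball_self hr, mem_ball_self hr, ζ₀, hζ₀, he₀⟩ ?_
      rintro z ⟨hzu, hz⟩
      obtain ⟨z', hz', α'', hα'', he'⟩ := hex z hz
      have hev := hopen z hz α'' hα'' ⟨z', hz', he'⟩
      obtain ⟨x, hx, hxu⟩ := mem_closure_iff_nhds.1 hzu _ hev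
      obtain ⟨x', hx', hex'⟩ := hx
      obtain ⟨-, x'', hx'', hex''⟩ := hxu
      have := (B'.chart_inj hx' hα'' hx'' hα' (hex'.trans hex''.symm)).2
      exact ⟨hz, z', hz', this ▸ he'⟩
    exact fun z hz => (hsub hz).2
  choose! φ hφT hφ using hmain
  refine ⟨r, hr, φ, ?_⟩
  filter_upwards [hT, hpb] with α hα hpα
  refine ⟨hφT α hα hpα, fun z hz => ⟨(hab (hrpa hz) hpα).2, ?_⟩⟩
  obtain ⟨z', hz', he'⟩ := hφ α hα hpα z hz
  rw [← he', coord_chart]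
  exact ⟨hz', rfl⟩

/-- The plaque of `B` with parameter `α` is infinitesimally invariant in the direction `v`. -/
def IsInvariant (B : FlowBox Λ X) (v : ℂ × ℂ) (α : ℂ) : Prop :=
  InfinitesimallyInvariant B.T B.δ B.graph (B.dir.place v).1 (B.dir.place v).2 α

theorem place_add_smul_sub (B : FlowBox Λ X) (v : ℂ × ℂ) (z w z' w' ε : ℂ) :
    B.dir.place (B.chart z w + ε • v - B.chart z' w') =
      (z + ε * (B.dir.place v).1 - z', B.graph w z + ε * (B.dir.place v).2 - B.graph w' z') := by
  rw [Direction.place_sub, Direction.place_add, Direction.place_smul, place_chart, place_chart]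
  ext
  · simp
    ring
  · simp

/-- Infinitesimal invariance does not depend on the flow box. -/
theorem IsInvariant.transfer {B B' : FlowBox Λ X} (h : B.MeetsOpenly B') (h' : B'.MeetsOpenly B)
    (hB : B.IsLipschitz) (hB' : B'.IsLipschitz) {v : ℂ × ℂ} {z₀ α₀ z₀' α₀' : ℂ}
    (hz₀ : z₀ ∈ ball 0 B.δ) (hα₀ : α₀ ∈ B.T) (hz₀' : z₀' ∈ ball 0 B'.δ) (hα₀' : α₀' ∈ B'.T)
    {l : ℂ × ℂ} (hl : l ∈ Λ) (he : B.chart z₀ α₀ + l = B'.chart z₀' α₀')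
    (hv : B.IsInvariant v α₀) : B'.IsInvariant v α₀' := by
  obtain ⟨C, hG⟩ := hB.lipFamily
  obtain ⟨C', hG'⟩ := hB'.lipFamily
  obtain ⟨r, hr, φ, hφ⟩ := h.exists_plaque_map hG hz₀ hα₀ hz₀' hα₀' hl he
  obtain ⟨α, β, ε, hp, hD⟩ := hv
  have tφ : Tendsto φ (𝓝[B.T] α₀) (𝓝 α₀') := by
    refine (tendsto_of_tendsto_chart hG' (z := fun α => B'.coord (B.chart z₀ α + l)) hz₀' hα₀'
      (hφ.mono fun _ h => h.1) ?_).2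
    have t : Tendsto (fun α => B.chart z₀ α + l) (𝓝[B.T] α₀) (𝓝 (B.chart z₀ α₀ + l)) :=
      (tendsto_chart hG hz₀ hα₀ eventually_mem_nhdsWithin
        (tendsto_id.mono_left nhdsWithin_le_nhds) tendsto_const_nhds).add_const l
    rw [he] at t
    refine t.congr' ?_
    filter_upwards [hφ] with α hα
    exact (hα.2 z₀ (mem_ball_self hr)).2.2.symm
  have tα : Tendsto α atTop (𝓝[B.T] α₀) :=
    tendsto_nhdsWithin_iff.2 ⟨hp.left, hp.mem_left⟩
  have tβ : Tendsto β atTop (𝓝[B.T] α₀) :=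
    tendsto_nhdsWithin_iff.2 ⟨hp.right, hp.mem_right⟩
  have hp' : ConvergentPairs B'.T α₀' (fun n => φ (α n)) (fun n => φ (β n)) ε :=
    ⟨(tα.eventually hφ).mono fun _ h => h.1, (tβ.eventually hφ).mono fun _ h => h.1, hp.ne_zero,
      tφ.comp tα, tφ.comp tβ, hp.zero⟩
  refine ⟨_, _, ε, hp', hG'.isLittleO_defect_of_ball hα₀' hz₀' hp' ?_⟩
  -- It is enough to treat `z'` near `z₀'`. Such points come from points `z` of the plaque `α₀` of
  -- `B`, where the gap is already known to be `o(ε)`.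
  have hrev := h'.eventually hz₀' hα₀' hz₀ hα₀ (Λ.neg_mem hl)
    (show B'.chart z₀' α₀' + -l = B.chart z₀ α₀ by rw [← he, add_neg_cancel_right])
  have hcoord : ∀ᶠ z' in 𝓝 z₀', B.coord (B'.chart z' α₀' + -l) ∈ ball z₀ r := by
    have hc : ContinuousAt (fun z' => B.coord (B'.chart z' α₀' + -l)) z₀' :=
      B.continuous_coord.continuousAt.comp
        ((B'.continuousAt_chart hz₀' hα₀').add continuousAt_const)
    refine hc.eventually_mem (isOpen_ball.mem_nhds ?_)
    rw [← he, add_neg_cancel_right, coord_chart]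
    exact mem_ball_self hr
  filter_upwards [hrev, hcoord] with z' hz' hzr
  set z := B.coord (B'.chart z' α₀' + -l) with hz
  have hez : B.chart z α₀ + l = B'.chart z' α₀' := by
    rw [hz'.2.2, neg_add_cancel_right]
  have hgap := hG.isLittleO_translateGap hα₀ hz'.2.1 hp (hD z hz'.2.1)
  set a := (B.dir.place v).1 with ha
  have tη : Tendsto (fun n => z - ε n * a) atTop (𝓝 z) := by
    simpa using (hp.zero.mul_const a).const_sub z
  have hlim : ∀ (x α : ℕ → ℂ), Tendsto x atTop (𝓝 z) → Tendsto α atTop (𝓝[B.T] α₀) →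
      Tendsto (fun n => B'.coord (B.chart (x n) (α n) + l)) atTop (𝓝 z') := by
    intro x α tx tα
    obtain ⟨tα1, tα2⟩ := tendsto_nhdsWithin_iff.1 tα
    have := (B'.continuous_coord.tendsto _).comp
      ((tendsto_chart hG hz'.2.1 hα₀ tα2 tα1 tx).add_const l)
    rwa [hez, coord_chart] at this
  set ξ := fun n => B'.coord (B.chart z (α n) + l)
  set η := fun n => B'.coord (B.chart (z - ε n * a) (β n) + l)
  -- Both points are moved by the same lattice vector `l`, which cancels in the difference. The
  -- error vector seen in `B'` is therefore the gap seen in `B`, possibly with its coordinates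
  -- exchanged, and both its components are `o(ε)`.
  have heq : ∀ᶠ n in atTop,
      B'.dir.place (B'.chart (η n) (φ (β n)) + ε n • v - B'.chart (ξ n) (φ (α n))) =
      B'.dir.place (B.dir.place (0, translateGap B.graph a (B.dir.place v).2 (α n) (β n) (ε n) z))
      := by
    filter_upwards [tα.eventually hφ, tβ.eventually hφ,
      tη.eventually (isOpen_ball.mem_nhds hzr)] with n h1 h2 h3
    rw [(h1.2 z hzr).2.2, (h2.2 _ h3).2.2]
    congr 1
    rw [← Direction.place_eq_iff, show B.chart (z - ε n * a) (β n) + l + ε n • v -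
      (B.chart z (α n) + l) = B.chart (z - ε n * a) (β n) + ε n • v - B.chart z (α n) by abel,
      place_add_smul_sub]
    simp [translateGap, ha]
  have hnorm : ∀ᶠ n in atTop,
      ‖B'.dir.place (B'.chart (η n) (φ (β n)) + ε n • v - B'.chart (ξ n) (φ (α n)))‖ ≤
      ‖translateGap B.graph a (B.dir.place v).2 (α n) (β n) (ε n) z‖ := by
    filter_upwards [heq] with n hn
    rw [hn, Direction.norm_place, Direction.norm_place, Prod.norm_def]
    simp
  simp only [place_add_smul_sub] at hnorm
  refine hG'.isLittleO_defect hα₀' hz'.1 hp' (hlim (fun _ => z) α tendsto_const_nhds tα)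
    (hlim _ β tη tβ) ?_ ?_
  · refine IsBigO.trans_isLittleO (IsBigO.of_bound 1 ?_) hgap
    filter_upwards [hnorm] with n hn
    rw [one_mul]
    exact (norm_fst_le _).trans hn
  · refine IsBigO.trans_isLittleO (IsBigO.of_bound 1 ?_) hgap
    filter_upwards [hnorm] with n hn
    rw [one_mul]
    exact (norm_snd_le _).trans hn

/-! ### Tangent lines, obliquity and the maximum principle -/

/-- A tangent vector of a plaque. -/
noncomputable def tangent (B : FlowBox Λ X) (z w : ℂ) : ℂ × ℂ :=
  B.dir.place (1, deriv (B.graph w) z)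

theorem tangent_ne_zero (B : FlowBox Λ X) (z w : ℂ) : B.tangent z w ≠ 0 := by
  rw [tangent, ne_eq, Direction.place_eq_iff]
  intro h
  have h1 := congrArg Prod.fst h
  cases hd : B.dir <;> simp [hd, Direction.place] at h1

theorem hasDerivAt_chart (B : FlowBox Λ X) {z w : ℂ} (hz : z ∈ ball 0 B.δ) (hw : w ∈ B.T) :
    HasDerivAt (fun x => B.chart x w) (B.tangent z w) z := by
  have h1 := ((B.graph_differentiableOn hw).differentiableAt (isOpen_ball.mem_nhds hz)).hasDerivAt
  have h2 : HasDerivAt (fun x => B.base + x) 1 z := (hasDerivAt_id z).const_add B.base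
  unfold tangent
  simp only [chart_eq]
  cases B.dir
  · exact h2.prodMk h1
  · exact h1.prodMk h2

/-- Plaques which meet are tangent to each other. -/
theorem MeetsOpenly.exists_tangent_eq {B B' : FlowBox Λ X} (h : B.MeetsOpenly B')
    {z₀ α₀ z₀' α₀' : ℂ} (hz₀ : z₀ ∈ ball 0 B.δ) (hα₀ : α₀ ∈ B.T) (hz₀' : z₀' ∈ ball 0 B'.δ)
    (hα₀' : α₀' ∈ B'.T) {l : ℂ × ℂ} (hl : l ∈ Λ) (he : B.chart z₀ α₀ + l = B'.chart z₀' α₀') :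
    ∃ c : ℂ, c ≠ 0 ∧ B.tangent z₀ α₀ = c • B'.tangent z₀' α₀' := by
  have hev := h.eventually hz₀ hα₀ hz₀' hα₀' hl he
  have h1 : HasDerivAt (fun z => B.chart z α₀ + l) (B.tangent z₀ α₀) z₀ :=
    (B.hasDerivAt_chart hz₀ hα₀).add_const l
  have h2 : DifferentiableAt ℂ (fun z => B'.coord (B.chart z α₀ + l)) z₀ := by
    unfold coord
    refine DifferentiableAt.sub_const ?_ _
    cases B'.dir
    · exact h1.differentiableAt.fst
    · exact h1.differentiableAt.snd
  have h3 : HasDerivAt (fun x => B'.chart x α₀') (B'.tangent z₀' α₀')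
      (B'.coord (B.chart z₀ α₀ + l)) := by
    rw [he, coord_chart]
    exact B'.hasDerivAt_chart hz₀' hα₀'
  have h4 := h3.scomp z₀ h2.hasDerivAt
  have h5 := h1.unique (h4.congr_of_eventuallyEq (hev.mono fun z hz => hz.2.2.symm))
  refine ⟨_, fun h0 => ?_, h5⟩
  rw [h0, zero_smul] at h5
  exact B.tangent_ne_zero _ _ h5

end FlowBox

/-- The relative size of the component along `v` of a tangent vector `t`, where `v` is a vector
of the standard basis. -/
noncomputable def obliquity (v t : ℂ × ℂ) : ℝ :=
  ‖v.1 * t.1 + v.2 * t.2‖ / (‖v.1 * t.2 - v.2 * t.1‖ + ‖v.1 * t.1 + v.2 * t.2‖)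

theorem obliquity_le_one (v t : ℂ × ℂ) : obliquity v t ≤ 1 := by
  refine div_le_one_of_le₀ ?_ (by positivity)
  linarith [norm_nonneg (v.1 * t.2 - v.2 * t.1)]

/-- Numerator and denominator are homogeneous of the same degree. The obliquity thus depends on the
tangent line only, and so not on the flow box. -/
theorem obliquity_smul (v t : ℂ × ℂ) {c : ℂ} (hc : c ≠ 0) :
    obliquity v (c • t) = obliquity v t := by
  have h1 : v.1 * (c • t).1 + v.2 * (c • t).2 = c * (v.1 * t.1 + v.2 * t.2) := by
    simp only [Prod.smul_fst, Prod.smul_snd, smul_eq_mul]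
    ring
  have h2 : v.1 * (c • t).2 - v.2 * (c • t).1 = c * (v.1 * t.2 - v.2 * t.1) := by
    simp only [Prod.smul_fst, Prod.smul_snd, smul_eq_mul]
    ring
  rw [obliquity, h1, h2, norm_mul, norm_mul, ← mul_add, mul_div_mul_left _ _ (norm_ne_zero_iff.2 hc)]
  rfl

theorem norm_le_of_div_le {x y : ℝ} (hx : 0 ≤ x) (hy : 0 ≤ y)
    (h : x / (1 + x) ≤ y / (1 + y)) : x ≤ y := by
  rw [div_le_div_iff₀ (by positivity) (by positivity)] at h
  linarith

namespace FlowBox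

variable {X : Set ((ℂ × ℂ) ⧸ Λ)}

/-- Maximal obliquity means maximal `|G'|` when `v` is transversal to the box and minimal `|G'|`
when `v` points along it; this decides to which function the maximum principle applies. -/
theorem place_basis (B : FlowBox Λ X) {v : ℂ × ℂ} (hv : v = (1, 0) ∨ v = (0, 1)) :
    (B.dir.place v = (0, 1) ∧ ∀ z w, obliquity v (B.tangent z w) =
      ‖deriv (B.graph w) z‖ / (1 + ‖deriv (B.graph w) z‖)) ∨
    (B.dir.place v = (1, 0) ∧ ∀ z w, obliquity v (B.tangent z w) =
      1 / (1 + ‖deriv (B.graph w) z‖)) := by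
  unfold tangent
  rcases hv with rfl | rfl <;> cases B.dir <;>
    simp [Direction.place, obliquity, add_comm]

theorem tendsto_obliquity {B : FlowBox Λ X} {C : ℝ} (hG : LipFamily B.T B.δ C B.graph)
    {v : ℂ × ℂ} (hv : v = (1, 0) ∨ v = (0, 1)) {z₀ α₀ : ℂ}
    (hz₀ : z₀ ∈ ball 0 B.δ) (hα₀ : α₀ ∈ B.T) {ι : Type*} {l : Filter ι} {z α : ι → ℂ}
    (hα : ∀ᶠ n in l, α n ∈ B.T) (tα : Tendsto α l (𝓝 α₀)) (tz : Tendsto z l (𝓝 z₀)) :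
    Tendsto (fun n => obliquity v (B.tangent (z n) (α n))) l
      (𝓝 (obliquity v (B.tangent z₀ α₀))) := by
  have h := (hG.tendsto_deriv hα₀ hz₀ hα tα tz).norm
  have hne : 1 + ‖deriv (B.graph α₀) z₀‖ ≠ 0 := by positivity
  rcases B.place_basis hv with ⟨-, ho⟩ | ⟨-, ho⟩
  · simp only [ho]
    exact h.div (h.const_add 1) hne
  · simp only [ho]
    exact (tendsto_const_nhds (x := (1 : ℝ))).div (h.const_add 1) hne

/-- A limit of infinitesimally invariant plaques at which the obliquity is maximal is flat. -/
theorem exists_deriv_eq_const {B : FlowBox Λ X} {C : ℝ} (hG : LipFamily B.T B.δ C B.graph)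
    {v : ℂ × ℂ} (hv : v = (1, 0) ∨ v = (0, 1)) {z₀ α₀ : ℂ}
    (hz₀ : z₀ ∈ ball 0 B.δ) (hα₀ : α₀ ∈ B.T) {z α : ℕ → ℂ} (hz : ∀ n, z n ∈ ball 0 B.δ)
    (hα : ∀ n, α n ∈ B.T) (tα : Tendsto α atTop (𝓝 α₀)) (tz : Tendsto z atTop (𝓝 z₀))
    (hinv : ∀ n, B.IsInvariant v (α n)) {M : ℝ}
    (hM : ∀ n, ∀ x ∈ ball 0 B.δ, obliquity v (B.tangent x (α n)) ≤ M)
    (tM : Tendsto (fun n => obliquity v (B.tangent (z n) (α n))) atTop (𝓝 M)) :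
    ∃ c, ∀ x ∈ ball 0 B.δ, deriv (B.graph α₀) x = c := by
  have hαe := Eventually.of_forall (f := atTop) hα
  have hle : ∀ x ∈ ball 0 B.δ,
      obliquity v (B.tangent x α₀) ≤ obliquity v (B.tangent z₀ α₀) := by
    intro x hx
    rw [tendsto_nhds_unique (tendsto_obliquity hG hv hz₀ hα₀ hαe tα tz) tM]
    exact le_of_tendsto (tendsto_obliquity hG hv hx hα₀ hαe tα tendsto_const_nhds)
      (.of_forall fun n => hM n x hx)
  have hd := (hG.diff α₀ hα₀).deriv isOpen_ball
  rcases B.place_basis hv with ⟨hp, ho⟩ | ⟨hp, ho⟩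
  · simp only [ho] at hle
    refine ⟨_, Complex.eq_const_of_exists_max hd hz₀ fun x hx => ?_⟩
    exact norm_le_of_div_le (norm_nonneg _) (norm_nonneg _) (hle x hx)
  · simp only [ho] at hle
    have hle' : ∀ x ∈ ball 0 B.δ, ‖deriv (B.graph α₀) z₀‖ ≤ ‖deriv (B.graph α₀) x‖ := by
      intro x hx
      have := (one_div_le_one_div (by positivity) (by positivity)).1 (hle x hx)
      linarith
    -- If `G'` vanishes at `z₀`, then `1/G'` is not available. Here `(a, b) = (1, 0)`, so `harnack`
    -- bounds `|G'|` on the approximating invariant plaques by `C²` times its value at `z n`, which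
    -- tends to `0`. Invariance of the limit plaque is not needed.
    by_cases h0 : deriv (B.graph α₀) z₀ = 0
    · refine ⟨0, fun x hx => ?_⟩
      have h1 := (hG.tendsto_deriv hα₀ hx hαe tα (tendsto_const_nhds (x := x))).norm
      have h2 := ((hG.tendsto_deriv hα₀ hz₀ hαe tα tz).norm).const_mul (C ^ 2)
      have h3 := le_of_tendsto_of_tendsto h1 h2 (.of_forall fun n => by
        have := hG.harnack (hinv n) hx (hz n)
        simpa [hp] using this)
      rw [h0, norm_zero, mul_zero] at h3
      exact norm_le_zero_iff.1 h3
    · have hne : ∀ x ∈ ball 0 B.δ, deriv (B.graph α₀) x ≠ 0 := fun x hx h =>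
        h0 (norm_le_zero_iff.1 ((hle' x hx).trans (by rw [h, norm_zero])))
      have hconst := Complex.eq_const_of_exists_max (hd.inv hne) hz₀ fun x hx => by
        simp only [mem_ofPred_eq, Function.comp_apply, Pi.inv_apply, norm_inv]
        exact inv_anti₀ (norm_pos_iff.2 h0) (hle' x hx)
      refine ⟨deriv (B.graph α₀) z₀, fun x hx => ?_⟩
      exact inv_injective (hconst hx)

end FlowBox

/-- A flat plaque is a piece of a complex line. -/
theorem hasInvariantLineSegment_of_deriv_eq_const {B : FlowBox Λ L.carrier} {α c : ℂ}
    (hα : α ∈ B.T) (h : ∀ x ∈ ball 0 B.δ, deriv (B.graph α) x = c) :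
    L.HasInvariantLineSegment := by
  have haff : ∀ z ∈ ball 0 B.δ, B.graph α z = B.graph α 0 + z * c := by
    intro z hz
    have hd := B.graph_differentiableOn hα
    have key := (convex_ball (0 : ℂ) B.δ).norm_image_sub_le_of_norm_deriv_le (C := 0)
      (f := fun x => B.graph α x - x * c)
      (fun x hx => (hd.differentiableAt (isOpen_ball.mem_nhds hx)).sub
        (differentiableAt_id.mul_const c)) (fun x hx => ?_) (mem_ball_self B.δ_pos) hz
    · have h1 : B.graph α z - z * c - (B.graph α 0 - 0 * c) = 0 := by simpa using key
      linear_combination h1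
    · have h2 := (((hd.differentiableAt (isOpen_ball.mem_nhds hx)).hasDerivAt).sub
        ((hasDerivAt_id x).mul_const c)).deriv
      rw [norm_le_zero_iff]
      refine Eq.trans h2 ?_
      rw [h x hx, one_mul, sub_self]
  have hne : B.dir.place (1, c) ≠ 0 := by
    rw [← h 0 (mem_ball_self B.δ_pos)]
    exact B.tangent_ne_zero 0 α
  have hpt : ∀ s : ℂ, B.dir.place (B.chart 0 α + s • B.dir.place (1, c)) =
      (B.base + s, B.graph α 0 + s * c) := by
    intro s
    rw [Direction.place_add, B.place_chart, Direction.place_smul, Direction.place_place]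
    simp
  -- The open set is the full cylinder over the disc: it cuts out of the line exactly the flat
  -- plaque.
  refine ⟨AffineSubspace.mk' (B.chart 0 α) (ℂ ∙ B.dir.place (1, c)),
    {q | B.coord q ∈ ball 0 B.δ}, ?_, isOpen_ball.preimage B.continuous_coord,
    ⟨B.chart 0 α, AffineSubspace.self_mem_mk' _ _, ?_⟩, ?_⟩
  · rw [AffineSubspace.direction_mk']
    exact finrank_span_singleton hne
  · rw [mem_ofPred_eq, B.coord_chart]
    exact mem_ball_self B.δ_pos
  · rintro q ⟨hqY, hqU⟩
    obtain ⟨s, hs⟩ := Submodule.mem_span_singleton.1 ((AffineSubspace.mem_mk').1 hqY)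
    have hq : q = B.chart 0 α + s • B.dir.place (1, c) := by
      rw [hs, vsub_eq_sub, add_sub_cancel]
    have hsb : s ∈ ball 0 B.δ := by
      rw [mem_ofPred_eq, hq, FlowBox.coord, hpt, add_sub_cancel_left] at hqU
      exact hqU
    have : q = B.chart s α := by
      rw [B.chart_eq, haff s hsb, ← hpt, Direction.place_place, hq]
    rw [this]
    exact (B.chart_mem hsb hα).1

/-- No plaque of a Lipschitz lamination without line segments is infinitesimally invariant. -/
theorem not_isInvariant (hLip : L.IsLipschitz) (hseg : ¬ L.HasInvariantLineSegment) {v : ℂ × ℂ}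
    (hv : v = (1, 0) ∨ v = (0, 1)) {B : FlowBox Λ L.carrier} (hB : L.IsFlowBox B)
    (hBL : B.IsLipschitz) {α : ℂ} (hα : α ∈ B.T) : ¬ B.IsInvariant v α := by
  intro hinv
  -- The supremum runs over all Lipschitz flow boxes, so that it also bounds the obliquity in
  -- whichever box contains the limit point.
  set S : Set ℝ := {θ | ∃ B : FlowBox Λ L.carrier, L.IsFlowBox B ∧ B.IsLipschitz ∧ ∃ α ∈ B.T,
    ∃ z ∈ ball 0 B.δ, B.IsInvariant v α ∧ obliquity v (B.tangent z α) = θ} with hS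
  have hbdd : BddAbove S := by
    refine ⟨1, ?_⟩
    rintro _ ⟨B, -, -, α, -, z, -, -, rfl⟩
    exact obliquity_le_one _ _
  -- Near every point the obliquity stays strictly below the supremum, since otherwise a flat plaque
  -- arises in the limit. Finitely many such neighbourhoods cover `X`, which contradicts the
  -- definition of the supremum.
  have hloc : ∀ x ∈ L.carrier, ∃ V ∈ 𝓝 x, ∃ c < sSup S, ∀ B : FlowBox Λ L.carrier,
      L.IsFlowBox B → B.IsLipschitz → ∀ α ∈ B.T, ∀ z ∈ ball 0 B.δ, B.IsInvariant v α →
      Λ.mkQ (B.chart z α) ∈ V → obliquity v (B.tangent z α) ≤ c := by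
    intro x hx
    by_contra! hcon
    obtain ⟨B', hB', ⟨q, hqU, rfl⟩, hBL'⟩ := hLip x hx
    obtain ⟨z₀, hz₀, α₀, hα₀, rfl⟩ := B'.exists_chart_eq hx hqU
    obtain ⟨C, hG⟩ := hBL'.lipFamily
    have hpos : ∀ n : ℕ, (0 : ℝ) < 1 / ((n : ℝ) + 1) := fun n => Nat.one_div_pos_of_nat
    have hV : ∀ n : ℕ, Λ.mkQ '' (B'.U ∩ ball (B'.chart z₀ α₀) (1 / ((n : ℝ) + 1))) ∈
        𝓝 (Λ.mkQ (B'.chart z₀ α₀)) := fun n =>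
      (Λ.isOpenMap_mkQ _ (B'.isOpen_U.inter isOpen_ball)).mem_nhds
        ⟨_, ⟨hqU, mem_ball_self (hpos n)⟩, rfl⟩
    choose Bs hBs hBsL αs hαs zs hzs hinvs hmem hgt using fun n : ℕ =>
      hcon _ (hV n) (sSup S - 1 / ((n : ℝ) + 1)) (sub_lt_self _ (hpos n))
    have hex : ∀ n : ℕ, ∃ ζ ∈ ball 0 B'.δ, ∃ w ∈ B'.T,
        B'.chart ζ w ∈ ball (B'.chart z₀ α₀) (1 / ((n : ℝ) + 1)) ∧ B'.IsInvariant v w ∧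
        sSup S - 1 / ((n : ℝ) + 1) < obliquity v (B'.tangent ζ w) := by
      intro n
      obtain ⟨q, ⟨hqU, hqb⟩, hq⟩ := hmem n
      obtain ⟨ζ, hζ, w, hw, rfl⟩ := B'.exists_chart_eq
        (by rw [hq]; exact ((Bs n).chart_mem (hzs n) (hαs n)).1) hqU
      obtain ⟨l, hl, he⟩ := mkQ_eq_iff.1 hq.symm
      have hm := (hBs n).meetsOpenly hB'
      have hm' := hB'.meetsOpenly (hBs n)
      refine ⟨ζ, hζ, w, hw, hqb, (hinvs n).transfer hm hm' (hBsL n) hBL' (hzs n) (hαs n) hζ hw hl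
        he, ?_⟩
      obtain ⟨c, hc, ht⟩ := hm.exists_tangent_eq (hzs n) (hαs n) hζ hw hl he
      have := hgt n
      rwa [ht, obliquity_smul _ _ hc] at this
    choose ζ hζ w hw hqb hinvw hlt using hex
    have tρ : Tendsto (fun n : ℕ => 1 / ((n : ℝ) + 1)) atTop (𝓝 0) :=
      tendsto_one_div_add_atTop_nhds_zero_nat
    have tchart : Tendsto (fun n => B'.chart (ζ n) (w n)) atTop (𝓝 (B'.chart z₀ α₀)) := by
      rw [tendsto_iff_dist_tendsto_zero]
      exact squeeze_zero (fun _ => dist_nonneg) (fun n => (mem_ball.1 (hqb n)).le) tρ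
    obtain ⟨tζ, tw⟩ := FlowBox.tendsto_of_tendsto_chart hG hz₀ hα₀ (.of_forall hw) tchart
    have hM : ∀ n, ∀ x ∈ ball 0 B'.δ, obliquity v (B'.tangent x (w n)) ≤ sSup S := fun n x hx =>
      le_csSup hbdd ⟨B', hB', hBL', w n, hw n, x, hx, hinvw n, rfl⟩
    have tM : Tendsto (fun n => obliquity v (B'.tangent (ζ n) (w n))) atTop (𝓝 (sSup S)) := by
      refine tendsto_of_tendsto_of_tendsto_of_le_of_le (by simpa using tρ.const_sub (sSup S))
        tendsto_const_nhds (fun n => (hlt n).le) fun n => hM n _ (hζ n)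
    obtain ⟨c, hc⟩ := FlowBox.exists_deriv_eq_const hG hv hz₀ hα₀ hζ hw tw tζ hinvw hM tM
    exact hseg (hasInvariantLineSegment_of_deriv_eq_const hα₀ hc)
  choose! V hV c hc hVc using hloc
  obtain ⟨t, htX, ht⟩ := L.isCompact_carrier.elim_nhds_subcover V hV
  have hcov : ∀ θ ∈ S, ∃ x ∈ t, θ ≤ c x := by
    rintro _ ⟨B, hB, hBL, α, hα, z, hz, hinv, rfl⟩
    obtain ⟨x, hx, hxV⟩ := mem_iUnion₂.1 (ht (B.chart_mem hz hα).1)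
    exact ⟨x, hx, hVc x (htX x hx) B hB hBL α hα z hz hinv hxV⟩
  have hSne : S.Nonempty := ⟨_, B, hB, hBL, α, hα, 0, mem_ball_self B.δ_pos, hinv, rfl⟩
  obtain ⟨θ, hθ⟩ := hSne
  obtain ⟨x₀, hx₀, -⟩ := hcov θ hθ
  obtain ⟨x₁, hx₁, hmax⟩ := t.exists_max_image c ⟨x₀, hx₀⟩
  have hle : sSup S ≤ c x₁ := csSup_le ⟨θ, hθ⟩ fun θ hθ => by
    obtain ⟨x, hx, h⟩ := hcov θ hθ
    exact h.trans (hmax x hx)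
  exact absurd hle (not_le.2 (hc x₁ (htX x₁ hx₁)))

/-! ### Shrinking flow boxes and reduction to zeros in `ℂ²` -/

namespace FlowBox

variable {X : Set ((ℂ × ℂ) ⧸ Λ)}

/-- A flow box can be restricted to a smaller disc and to a smaller transversal. -/
theorem exists_restrict (B : FlowBox Λ X) {α₀ : ℂ} (hα₀ : α₀ ∈ B.T) {R η : ℝ} (hR0 : 0 < R)
    (hR : R < B.δ) (hη : 0 < η) :
    ∃ B' : FlowBox Λ X, B'.chart = B.chart ∧ B'.δ = R ∧
      B'.T = B.T ∩ ball α₀ η := by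
  have hVo : IsOpen {p : (ball (0 : ℂ) B.δ ×ˢ B.T : Set (ℂ × ℂ)) |
      p.1.1 ∈ ball (0 : ℂ) R ∧ p.1.2 ∈ ball α₀ η} :=
    (isOpen_ball.preimage (continuous_fst.comp continuous_subtype_val)).inter
      (isOpen_ball.preimage (continuous_snd.comp continuous_subtype_val))
  -- Since the parametrization is a homeomorphism onto its image, the smaller box is cut out by an
  -- open set `W` of `ℂ²`.
  obtain ⟨W, hWo, hW⟩ := B.isEmbedding.isInducing.isOpen_iff.1 hVo
  have hW' : ∀ z ∈ ball (0 : ℂ) B.δ, ∀ w ∈ B.T,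
      B.chart z w ∈ W ↔ z ∈ ball (0 : ℂ) R ∧ w ∈ ball α₀ η := by
    intro z hz w hw
    exact Set.ext_iff.1 hW ⟨(z, w), hz, hw⟩
  have hball : ball (0 : ℂ) R ⊆ ball 0 B.δ := ball_subset_ball hR.le
  have hsub : ball (0 : ℂ) R ×ˢ (B.T ∩ ball α₀ η) ⊆ ball 0 B.δ ×ˢ B.T :=
    prod_mono hball inter_subset_left
  refine ⟨
    { dir := B.dir
      base := B.base
      height := α₀
      δ := R
      U := B.U ∩ W
      T := B.T ∩ ball α₀ η
      f := B.f
      δ_pos := hR0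
      height_mem := ⟨hα₀, mem_ball_self hη⟩
      isOpen_U := B.isOpen_U.inter hWo
      injOn_U := B.injOn_U.mono inter_subset_left
      holo := fun w hw => (B.holo w hw.1).mono hball
      f_zero := fun w hw => B.f_zero w hw.1
      image_eq := ?_
      isEmbedding := B.isEmbedding.comp (Topology.IsEmbedding.inclusion hsub) }, rfl, rfl, rfl⟩
  rw [← inter_assoc, ← B.image_eq]
  ext q
  constructor
  · rintro ⟨⟨z, w⟩, ⟨hz, hw⟩, rfl⟩
    exact ⟨⟨(z, w), ⟨hball hz, hw.1⟩, rfl⟩, (hW' z (hball hz) w hw.1).2 ⟨hz, hw.2⟩⟩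
  · rintro ⟨⟨⟨z, w⟩, ⟨hz, hw⟩, rfl⟩, hqW⟩
    have := (hW' z hz w hw).1 hqW
    exact ⟨(z, w), ⟨this.1, hw, this.2⟩, rfl⟩

theorem norm_chart_sub_le {B : FlowBox Λ X} {C : ℝ} (hG : LipFamily B.T B.δ C B.graph) {z α β : ℂ}
    (hz : z ∈ ball 0 B.δ) (hα : α ∈ B.T) (hβ : β ∈ B.T) :
    ‖B.chart z α - B.chart z β‖ ≤ C * ‖α - β‖ := by
  rw [chart_eq, chart_eq, ← Direction.place_sub, Direction.norm_place, Prod.norm_def]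
  simpa using hG.upper α hα β hβ z hz

/-- Small translates of plaques near a given one only meet plaques near it, over a smaller disc,
without the help of the lattice. -/
theorem exists_eq_zero_of_add_mem [DiscreteTopology Λ] {B : FlowBox Λ X} {C : ℝ}
    (hG : LipFamily B.T B.δ C B.graph) {α₀ : ℂ} (hα₀ : α₀ ∈ B.T) {R : ℝ} (hR : R < B.δ) :
    ∃ η : ℝ, 0 < η ∧ ∀ α ∈ B.T, ∀ β ∈ B.T, ‖α - α₀‖ < η → ‖β - α₀‖ < η →
      ∀ z ∈ closedBall 0 R, ∀ y ∈ closedBall 0 R, ∀ u : ℂ × ℂ, ‖u‖ < η → ∀ l ∈ Λ,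
      B.chart z α + l = B.chart y β + u → l = 0 := by
  have hC := hG.pos
  have hsub : closedBall (0 : ℂ) R ⊆ ball 0 B.δ := closedBall_subset_ball hR
  have hcont : ContinuousOn (fun z => B.chart z α₀) (closedBall 0 R) := fun z hz =>
    (B.continuousAt_chart (hsub hz) hα₀).continuousWithinAt
  have hK : IsCompact ((fun p : ℂ × ℂ => B.chart p.2 α₀ - B.chart p.1 α₀) ''
      (closedBall 0 R ×ˢ closedBall 0 R)) := by
    refine ((isCompact_closedBall _ _).prod (isCompact_closedBall _ _)).image_of_continuousOn ?_
    exact (hcont.comp continuousOn_snd fun p hp => hp.2).sub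
      (hcont.comp continuousOn_fst fun p hp => hp.1)
  obtain ⟨r, hr, hrΛ⟩ : ∃ r : ℝ, 0 < r ∧ ∀ l ∈ Λ, ‖l‖ < r → l = 0 := by
    obtain ⟨r, hr, h⟩ := Metric.isOpen_singleton_iff.1 (isOpen_discrete ({0} : Set Λ))
    refine ⟨r, hr, fun l hl hlr => ?_⟩
    have := h ⟨l, hl⟩ (by rw [dist_zero_right]; exact hlr)
    exact congrArg Subtype.val this
  -- Discreteness at `0` separates all lattice points uniformly, so the nonzero ones form a closed
  -- set. It misses the compact set of differences of points of the plaque `α₀`, because `π` is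
  -- injective on the box.
  have hF : IsClosed {l : ℂ × ℂ | l ∈ Λ ∧ l ≠ 0} := by
    refine Metric.isClosed_of_pairwise_le_dist hr ?_
    rintro l ⟨hl, -⟩ m ⟨hm, -⟩ hne
    by_contra! hlt
    rw [dist_eq_norm] at hlt
    exact hne (sub_eq_zero.1 (hrΛ _ (Λ.sub_mem hl hm) hlt))
  have hdisj : Disjoint ((fun p : ℂ × ℂ => B.chart p.2 α₀ - B.chart p.1 α₀) ''
      (closedBall 0 R ×ˢ closedBall 0 R)) {l : ℂ × ℂ | l ∈ Λ ∧ l ≠ 0} := by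
    rw [Set.disjoint_left]
    rintro _ ⟨⟨z, y⟩, ⟨hz, hy⟩, rfl⟩ ⟨hl, hne⟩
    refine hne (sub_eq_zero.2 ?_)
    refine B.injOn_U (B.chart_mem (hsub hy) hα₀).2 (B.chart_mem (hsub hz) hα₀).2 ?_
    exact (mkQ_eq_iff.2 ⟨_, hl, add_sub_cancel _ _⟩).symm
  obtain ⟨d, hd, hdd⟩ := hdisj.exists_cthickenings hK hF
  -- Replacing `α` and `β` by `α₀` costs `C η` each and dropping `u` costs `η`; the total is `d` for
  -- this choice of `η`.
  refine ⟨d / (2 * C + 1), by positivity, fun α hα β hβ hα' hβ' z hz y hy u hu l hl he => ?_⟩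
  by_contra hne
  refine Set.disjoint_left.1 hdd ?_ (self_subset_cthickening _ ⟨hl, hne⟩)
  refine mem_cthickening_of_dist_le l (B.chart y α₀ - B.chart z α₀) _ _ ⟨(z, y), ⟨hz, hy⟩, rfl⟩ ?_
  have hdec : l - (B.chart y α₀ - B.chart z α₀) =
      (B.chart y β - B.chart y α₀) - (B.chart z α - B.chart z α₀) + u := by
    rw [eq_sub_of_add_eq' he]
    abel
  rw [dist_eq_norm, hdec]
  have h1 := norm_chart_sub_le hG (hsub hy) hβ hα₀
  have h2 := norm_chart_sub_le hG (hsub hz) hα hα₀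
  calc _ ≤ ‖B.chart y β - B.chart y α₀‖ + ‖B.chart z α - B.chart z α₀‖ + ‖u‖ :=
        (norm_add_le _ _).trans (add_le_add_left (norm_sub_le _ _) _)
    _ ≤ C * (d / (2 * C + 1)) + C * (d / (2 * C + 1)) + d / (2 * C + 1) := by
        gcongr
        · exact h1.trans (by gcongr)
        · exact h2.trans (by gcongr)
    _ = d := by
        field_simp
        ring

end FlowBox

/-- The restriction of a flow box of a lamination is a flow box of the lamination. -/
theorem IsFlowBox.restrict {B B' : FlowBox Λ L.carrier} (hB : L.IsFlowBox B)
    (hchart : B'.chart = B.chart) (hδ : B'.δ ≤ B.δ)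
    (hT : B'.T ⊆ B.T) : L.IsFlowBox B' := by
  have hball : ball (0 : ℂ) B'.δ ⊆ ball 0 B.δ := ball_subset_ball hδ
  refine fun B'' hB'' => ⟨FlowBox.meetsOpenly_of_eventually
    fun z₀ hz₀ w hw z₀' hz₀' w' hw' l hl he => ?_, FlowBox.meetsOpenly_of_eventually
    fun z₀ hz₀ w hw z₀' hz₀' w' hw' l hl he => ?_⟩
  · rw [hchart] at he ⊢
    filter_upwards [(hB B'' hB'').1.eventually (hball hz₀) (hT hw) hz₀' hw' hl he] with z hz
    exact ⟨_, hz.2.1, hz.2.2⟩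
  · rw [hchart] at he ⊢
    have hc : ContinuousAt (fun z => B.coord (B''.chart z w + l)) z₀ :=
      B.continuous_coord.continuousAt.comp
        ((B''.continuousAt_chart hz₀ hw).add continuousAt_const)
    have hmem : ∀ᶠ z in 𝓝 z₀, B.coord (B''.chart z w + l) ∈ ball 0 B'.δ := by
      refine hc.eventually_mem (isOpen_ball.mem_nhds ?_)
      rwa [he, FlowBox.coord_chart]
    filter_upwards [(hB B'' hB'').2.eventually hz₀ hw (hball hz₀') (hT hw') hl he, hmem]
      with z hz hz'
    exact ⟨_, hz', hz.2.2⟩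

/-- The crossings of a plaque with a translate are zeros of the gap between them. -/
theorem crossings_le_encard {X : Set ((ℂ × ℂ) ⧸ Λ)} {B B' : FlowBox Λ X}
    (hchart : B'.chart = B.chart) {v : ℂ × ℂ} {ε α β : ℂ}
    (h : ∀ z ∈ closedBall 0 B'.δ, ∀ y ∈ closedBall 0 B'.δ, ∀ l ∈ Λ,
      B.chart z α + l = B.chart y β + ε • v → l = 0) :
    crossings Λ (B'.plaque α) (B'.plaque β) (ε • v) ≤
      {z ∈ closedBall (0 : ℂ) B'.δ |
        translateGap B.graph (B.dir.place v).1 (B.dir.place v).2 α β ε z = 0}.encard := by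
  refine le_trans (Set.encard_le_encard ?_)
    (Set.encard_image_le (fun z => Λ.mkQ (B.chart z α)) _)
  rintro _ ⟨⟨_, ⟨z, hz, rfl⟩, rfl⟩, ⟨_, ⟨_, ⟨y, hy, rfl⟩, rfl⟩, hq⟩⟩
  simp only [hchart] at hq ⊢
  have hz' := ball_subset_closedBall hz
  obtain ⟨l, hl, he⟩ := mkQ_eq_iff.1 hq.symm
  have hl0 := h z hz' y (ball_subset_closedBall hy) l hl he
  rw [hl0, add_zero] at he
  have h0 := B.place_add_smul_sub v y β z α ε
  rw [← he, sub_self] at h0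
  have h00 : B.dir.place 0 = 0 := by cases B.dir <;> rfl
  rw [h00] at h0
  have h1 := (congrArg Prod.fst h0).symm
  have h2 := (congrArg Prod.snd h0).symm
  simp only [Prod.fst_zero, Prod.snd_zero] at h1 h2
  refine ⟨z, ⟨hz', ?_⟩, rfl⟩
  rw [translateGap, ← sub_eq_zero.1 h1, add_sub_cancel_right, sub_eq_zero.1 h1]
  exact h2

/-- Every point of a Lipschitz lamination without line segments lies in a flow box in which the
number of crossings of plaques with small translates of plaques is bounded. -/
theorem exists_flowBox_crossings_lt [DiscreteTopology Λ] (hLip : L.IsLipschitz)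
    (hseg : ¬ L.HasInvariantLineSegment) {x : (ℂ × ℂ) ⧸ Λ} (hx : x ∈ L.carrier) :
    ∃ (B : FlowBox Λ L.carrier) (N : ℕ) (ε₀ : ℝ), L.IsFlowBox B ∧ x ∈ Λ.mkQ '' B.U ∧ 0 < ε₀ ∧
      ∀ α ∈ B.T, ∀ β ∈ B.T, ∀ ε : ℂ, 0 < ‖ε‖ → ‖ε‖ < ε₀ →
        crossings Λ (B.plaque α) (B.plaque β) (ε, 0) < N ∧
        crossings Λ (B.plaque α) (B.plaque β) (0, ε) < N := by
  obtain ⟨B, hB, ⟨q, hqU, rfl⟩, hBL⟩ := hLip x hx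
  obtain ⟨z₀, hz₀, α₀, hα₀, rfl⟩ := B.exists_chart_eq hx hqU
  obtain ⟨C, hG⟩ := hBL.lipFamily
  obtain ⟨R, hzR, hR⟩ := exists_between (mem_ball.1 hz₀)
  obtain ⟨η, hη, hret⟩ := FlowBox.exists_eq_zero_of_add_mem hG hα₀ hR
  obtain ⟨ρ₁, hρ₁, N₁, hN₁⟩ := hG.exists_bound_zeros hα₀
    (not_isInvariant hLip hseg (v := (1, 0)) (Or.inl rfl) hB hBL hα₀) hR
  obtain ⟨ρ₂, hρ₂, N₂, hN₂⟩ := hG.exists_bound_zeros hα₀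
    (not_isInvariant hLip hseg (v := (0, 1)) (Or.inr rfl) hB hBL hα₀) hR
  set ρ := min η (min ρ₁ ρ₂) with hρ
  have hρ0 : 0 < ρ := lt_min hη (lt_min hρ₁ hρ₂)
  have hρη : ρ ≤ η := min_le_left _ _
  have hρ1 : ρ ≤ ρ₁ := (min_le_right _ _).trans (min_le_left _ _)
  have hρ2 : ρ ≤ ρ₂ := (min_le_right _ _).trans (min_le_right _ _)
  obtain ⟨B', hchart, hδ, hT⟩ :=
    B.exists_restrict hα₀ (dist_nonneg.trans_lt hzR) hR hρ0
  -- The sum serves the horizontal and the vertical translates at once; the added `1` makes the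
  -- inequality strict.
  refine ⟨B', N₁ + N₂ + 1, ρ, hB.restrict hchart (hδ.trans_le hR.le)
    (hT ▸ inter_subset_left), ⟨B.chart z₀ α₀, ?_, rfl⟩, hρ0, ?_⟩
  · rw [← hchart]
    exact (B'.chart_mem (by rw [hδ]; exact hzR) (hT ▸ ⟨hα₀, mem_ball_self hρ0⟩)).2
  · intro α hα β hβ ε hε0 hε
    rw [hT] at hα hβ
    have hαρ : ‖α - α₀‖ < ρ := mem_ball_iff_norm.1 hα.2
    have hβρ : ‖β - α₀‖ < ρ := mem_ball_iff_norm.1 hβ.2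
    have hcross : ∀ v : ℂ × ℂ, ‖v‖ = 1 →
        crossings Λ (B'.plaque α) (B'.plaque β) (ε • v) ≤ {z ∈ closedBall (0 : ℂ) R |
          translateGap B.graph (B.dir.place v).1 (B.dir.place v).2 α β ε z = 0}.encard := by
      intro v hv
      have := crossings_le_encard (α := α) (β := β) (v := v) (ε := ε) hchart
      rw [hδ] at this
      refine this fun z hz y hy l hl he => hret α hα.1 β hβ.1 (hαρ.trans_le hρη)
        (hβρ.trans_le hρη) z hz y hy (ε • v) ?_ l hl he
      rw [norm_smul, hv, mul_one]
      exact hε.trans_le hρη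
    have h1 := (hcross (1, 0) (by simp [Prod.norm_def])).trans
      (hN₁ α hα.1 β hβ.1 ε (hαρ.trans_le hρ1) (hβρ.trans_le hρ1) hε0 (hε.trans_le hρ1))
    have h2 := (hcross (0, 1) (by simp [Prod.norm_def])).trans
      (hN₂ α hα.1 β hβ.1 ε (hαρ.trans_le hρ2) (hβρ.trans_le hρ2) hε0 (hε.trans_le hρ2))
    simp only [Prod.smul_mk, smul_eq_mul, mul_one, mul_zero] at h1 h2
    exact ⟨h1.trans_lt (by exact_mod_cast (by omega : N₁ < N₁ + N₂ + 1)),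
      h2.trans_lt (by exact_mod_cast (by omega : N₂ < N₁ + N₂ + 1))⟩

end TorusLamination

open TorusLamination Set in
theorem mainTheorem5 (Λ : Submodule ℤ (ℂ × ℂ)) [DiscreteTopology Λ] [IsZLattice ℝ Λ]
    (L : TorusLamination Λ) (hLip : L.IsLipschitz) (hseg : ¬ L.HasInvariantLineSegment) :
    ∃ (𝒰 : Set (TorusLamination.FlowBox Λ L.carrier)) (N : ℕ) (ε₀ : ℝ),
      𝒰.Finite ∧ (∀ B ∈ 𝒰, L.IsFlowBox B) ∧
      L.carrier ⊆ ⋃ B ∈ 𝒰, Λ.mkQ '' B.U ∧ 0 < ε₀ ∧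
      ∀ B ∈ 𝒰, ∀ α ∈ B.T, ∀ β ∈ B.T, ∀ ε : ℂ, 0 < ‖ε‖ → ‖ε‖ < ε₀ →
        TorusLamination.crossings Λ (B.plaque α) (B.plaque β) (ε, 0) < N ∧
        TorusLamination.crossings Λ (B.plaque α) (B.plaque β) (0, ε) < N := by
  -- Having a finite covering with uniform constants passes to subsets and to unions of two sets (`N
  -- + N'` and the smaller radius serve both), so it suffices to verify it near each point.
  refine L.isCompact_carrier.induction_on (p := fun t => ∃ (𝒰 : Set (FlowBox Λ L.carrier))
    (N : ℕ) (ε₀ : ℝ), 𝒰.Finite ∧ (∀ B ∈ 𝒰, L.IsFlowBox B) ∧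
    t ⊆ ⋃ B ∈ 𝒰, Λ.mkQ '' B.U ∧ 0 < ε₀ ∧
    ∀ B ∈ 𝒰, ∀ α ∈ B.T, ∀ β ∈ B.T, ∀ ε : ℂ, 0 < ‖ε‖ → ‖ε‖ < ε₀ →
      crossings Λ (B.plaque α) (B.plaque β) (ε, 0) < N ∧
      crossings Λ (B.plaque α) (B.plaque β) (0, ε) < N) ?_ ?_ ?_ ?_
  · exact ⟨∅, 0, 1, by simp⟩
  · rintro s t hst ⟨𝒰, N, ε₀, h1, h2, h3, h4⟩
    exact ⟨𝒰, N, ε₀, h1, h2, hst.trans h3, h4⟩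
  · rintro s t ⟨𝒰, N, ε₀, h1, h2, h3, h4, h5⟩ ⟨𝒰', N', ε₀', h1', h2', h3', h4', h5'⟩
    have hN : ((N : ℕ∞)) ≤ ((N + N' : ℕ) : ℕ∞) := by exact_mod_cast Nat.le_add_right N N'
    have hN' : ((N' : ℕ∞)) ≤ ((N + N' : ℕ) : ℕ∞) := by exact_mod_cast Nat.le_add_left N' N
    refine ⟨𝒰 ∪ 𝒰', N + N', min ε₀ ε₀', h1.union h1', ?_, ?_, lt_min h4 h4', ?_⟩
    · rintro B (hB | hB)
      · exact h2 B hB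
      · exact h2' B hB
    · rw [biUnion_union]
      exact union_subset_union h3 h3'
    · rintro B (hB | hB) α hα β hβ ε hε hε'
      · obtain ⟨ha, hb⟩ := h5 B hB α hα β hβ ε hε (hε'.trans_le (min_le_left _ _))
        exact ⟨ha.trans_le hN, hb.trans_le hN⟩
      · obtain ⟨ha, hb⟩ := h5' B hB α hα β hβ ε hε (hε'.trans_le (min_le_right _ _))
        exact ⟨ha.trans_le hN', hb.trans_le hN'⟩
  · intro x hx
    obtain ⟨B, N, ε₀, hB, hxB, hε₀, h⟩ := exists_flowBox_crossings_lt hLip hseg hx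
    refine ⟨Λ.mkQ '' B.U, mem_nhdsWithin_of_mem_nhds
      ((Λ.isOpenMap_mkQ _ B.isOpen_U).mem_nhds hxB), {B}, N, ε₀, finite_singleton B, ?_, ?_,
      hε₀, ?_⟩
    · rintro _ rfl
      exact hB
    · simp
    · rintro _ rfl
      exact h
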